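/- **Theorem (convergence rate of online Sinkhorn).** Let $\mathcal X\subset\mathbb R^d$ be compact, $\alpha,\beta$ Borel probability measures on $\mathcal X$, $C:\mathcal X\times\mathcal X\to\mathbb R$ Lipschitz and $\varepsilon>0$. Let $(f^*,g^*)$ be a pair of optimal potentials: a pair of continuous functions on $\mathcal X$ maximising $$\int f\,d\alpha+\int g\,d\beta-\varepsilon\int e^{(f(x)+g(y)-C(x,y))/\varepsilon}\,d\alpha(x)\,d\beta(y)$$ over all pairs of continuous functions, in the version with $f^*(x)=-\varepsilon\log\int e^{(g^*(y)-C(x,y))/\varepsilon}d\beta(y)$ and $g^*(y)=-\varepsilon\log\int e^{(f^*(x)-C(x,y))/\varepsilon}d\alpha(x)$ for all $x,y\in\mathcal X$. Let $-1<b<-\tfrac12$ and $a-b>1$, and for $t\ge1$ let $\eta_t=t^b$ and let $b_t=t^{2a}$, rounded (up or down) to a neighbouring integer. Online Sinkhorn uses independent samples $x_i\sim\alpha$, $y_i\sim\beta$, $i=1,2,\dots$ (all of them mutually independent). It starts from $n_0\ge1$ samples and $$e^{-f_0/\varepsilon}=\sum_{i\le n_0}e^{-C(\cdot,y_i)/\varepsilon},\qquad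 e^{-g_0/\varepsilon}=\sum_{i\le n_0}e^{-C(x_i,\cdot)/\varepsilon}.$$ Iteration $t\ge1$ draws the $b_t$ new samples with indices $n_{t-1}<i\le n_t:=n_{t-1}+b_t$ and sets $$e^{-f_t/\varepsilon}=(1-\eta_t)e^{-f_{t-1}/\varepsilon}+\frac{\eta_t}{b_t}\sum_{n_{t-1}<i\le n_t}e^{(g_{t-1}(y_i)-C(\cdot,y_i))/\varepsilon},$$ $$e^{-g_t/\varepsilon}=(1-\eta_t)e^{-g_{t-1}/\varepsilon}+\frac{\eta_t}{b_t}\sum_{n_{t-1}<i\le n_t}e^{(f_t(x_i)-C(x_i,\cdot))/\varepsilon}.$$ For an integer $N\ge1$ let $t(N)$ be the first $t$ with $\sum_{i=1}^t b_i>N$, let $\|h\|_{var}=\sup_{\mathcal X}h-\inf_{\mathcal X}h$, and let $$\delta_N=\mathbb E\Big[\big\|(f_{t(N)}-f^*)/\varepsilon\big\|_{var}+\big\|(g_{t(N)}-g^*)/\varepsilon\big\|_{var}\Big].$$ Then this random error is integrable, and there are constants $c,K>0$, depending only on $\mathcal X,\alpha,\beta,C,\varepsilon,f^*,g^*,a,b$,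 such that for all $N\ge1$ $$\delta_N\le K\Big(\exp\big(-cN^{\frac{b+1}{2a+1}}\big)+N^{-\frac a{2a+1}}\Big),$$ where the right-hand side is $O\big(N^{-\frac a{2a+1}}\big)$ as $N\to\infty$; hence $\delta_N=O\big(N^{-\frac a{2a+1}}\big)$. -/

import Mathlib

open MeasureTheory ProbabilityTheory Filter
open scoped NNReal Topology

noncomputable section

namespace OnlineSinkhorn

/-- The variation (oscillation) norm `sup h - inf h`. -/
def varNorm {E : Type*} (h : E → ℝ) : ℝ :=
  (⨆ z, h z) - ⨅ z, h z

/-- The dual objective of entropic optimal transport,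
`∫ f dα + ∫ g dβ - ε ∫ exp ((f ⊕ g - C) / ε) d(α ⊗ β)`. -/
def dualObjective {E : Type*} [MeasurableSpace E] (ε : ℝ) (C : E → E → ℝ)
    (α β : Measure E) (f g : E → ℝ) : ℝ :=
  (∫ x, f x ∂α) + (∫ y, g y ∂β)
    - ε * ∫ z : E × E, Real.exp ((f z.1 + g z.2 - C z.1 z.2) / ε) ∂(α.prod β)

/-- The soft `C`-transform `T_μ (h) = -ε log ∫ exp ((h y - C(·, y)) / ε) dμ(y)`. -/
def softTransform {E : Type*} [MeasurableSpace E] (ε : ℝ) (C : E → E → ℝ)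
    (μ : Measure E) (h : E → ℝ) (x : E) : ℝ :=
  -ε * Real.log (∫ y, Real.exp ((h y - C x y) / ε) ∂μ)

/-- `(f, g)` is a pair of optimal potentials: continuous functions that maximise the dual objective
over all pairs of continuous functions and are the soft `C`-transforms of each other at every point.
A maximiser satisfies the two equations `α`-a.e. and `β`-a.e.; asking for them at every
point selects its canonical version off the supports of `α` and `β`, which the
dual objective does not see. -/
structure IsOptimalPair {E : Type*} [TopologicalSpace E] [MeasurableSpace E] (ε : ℝ)
    (C : E → E → ℝ) (α β : Measure E) (f g : C(E, ℝ)) : Prop where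
  isMax : ∀ f' g' : C(E, ℝ), dualObjective ε C α β f' g' ≤ dualObjective ε C α β f g
  eq_left : ∀ x, f x = softTransform ε C β g x
  eq_right : ∀ y, g y = softTransform ε (fun y x => C x y) α f y

/-- The number of samples (from each of `α`, `β`) available after `t` iterations: `n₀` initial ones
and a batch of size `B i` in each iteration `i = 1, …, t`. -/
def sampleCount (n₀ : ℕ) (B : ℕ → ℕ) (t : ℕ) : ℕ :=
  n₀ + ∑ i ∈ Finset.Icc 1 t, B i

/-- The potential `-ε log ∑_{i < n} w i * exp (-(C · (z i)) / ε)` carried by the points `z i` with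
the (exponentiated) weights `w i`. -/
def weightedPotential {E : Type*} (ε : ℝ) (C : E → E → ℝ) (n : ℕ) (w : ℕ → ℝ) (z : ℕ → E)
    (x : E) : ℝ :=
  -ε * Real.log (∑ i ∈ Finset.range n, w i * Real.exp (-C x (z i) / ε))

/-- The memory of the algorithm: the exponentiated weights `q i = exp (q_i / ε)` at the points `y i`
and `p i = exp (p_i / ε)` at the points `x i`. -/
@[ext] structure Weights where
  q : ℕ → ℝ
  p : ℕ → ℝ

/-- One weight update: of the `n` old weights and `m` new points with indices `n ≤ i < n + m`, the
old weights are multiplied by `1 - η`, and the new point `i` gets the weight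
`(η / m) * exp (h i / ε)`, where `h i` is the value there of the opposite potential. -/
def updateWeights (ε η : ℝ) (n m : ℕ) (w : ℕ → ℝ) (h : ℕ → ℝ) (i : ℕ) : ℝ :=
  if i < n then (1 - η) * w i
  else if i < n + m then η / m * Real.exp (h i / ε)
  else 0

/-- The weights after `t` iterations of online Sinkhorn, run on the sample streams `x` (from `α`)
and `y` (from `β`). Iteration `t + 1` uses the step size `η (t + 1)` and the batch of
points with indices `n_t ≤ i < n_{t+1}`, whose size is `B (t + 1)`. -/
def weights {E : Type*} (ε : ℝ) (C : E → E → ℝ) (η : ℕ → ℝ) (n₀ : ℕ) (B : ℕ → ℕ)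
    (x y : ℕ → E) : ℕ → Weights
  | 0 => ⟨fun i => if i < n₀ then 1 else 0, fun i => if i < n₀ then 1 else 0⟩
  | t + 1 =>
    let w := weights ε C η n₀ B x y t
    let n := sampleCount n₀ B t
    let m := B (t + 1)
    let g : E → ℝ := weightedPotential ε (fun y x => C x y) n w.p x
    let q' : ℕ → ℝ := updateWeights ε (η (t + 1)) n m w.q (fun i => g (y i))
    let f' : E → ℝ := weightedPotential ε C (n + m) q' y
    let p' : ℕ → ℝ := updateWeights ε (η (t + 1)) n m w.p (fun i => f' (x i))
    ⟨q', p'⟩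

/-- The first potential `f_t` after `t` iterations. -/
def potentialF {E : Type*} (ε : ℝ) (C : E → E → ℝ) (η : ℕ → ℝ) (n₀ : ℕ) (B : ℕ → ℕ)
    (x y : ℕ → E) (t : ℕ) : E → ℝ :=
  weightedPotential ε C (sampleCount n₀ B t) (weights ε C η n₀ B x y t).q y

/-- The second potential `g_t` after `t` iterations. -/
def potentialG {E : Type*} (ε : ℝ) (C : E → E → ℝ) (η : ℕ → ℝ) (n₀ : ℕ) (B : ℕ → ℕ)
    (x y : ℕ → E) (t : ℕ) : E → ℝ :=
  weightedPotential ε (fun y x => C x y) (sampleCount n₀ B t) (weights ε C η n₀ B x y t).p x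

/-- The error `‖(f_t - f) / ε‖_var + ‖(g_t - g) / ε‖_var` of the iterates with respect to `(f, g)`. -/
def potentialError {E : Type*} (ε : ℝ) (C : E → E → ℝ) (η : ℕ → ℝ) (n₀ : ℕ) (B : ℕ → ℕ)
    (f g : E → ℝ) (x y : ℕ → E) (t : ℕ) : ℝ :=
  varNorm (fun z => (potentialF ε C η n₀ B x y t z - f z) / ε)
    + varNorm (fun z => (potentialG ε C η n₀ B x y t z - g z) / ε)

/-- The first iteration number `t` for which `B 1 + ⋯ + B t > N`. -/
def iterationOf (B : ℕ → ℕ) (N : ℕ) : ℕ :=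
  sInf {t : ℕ | N < ∑ i ∈ Finset.Icc 1 t, B i}

end OnlineSinkhorn

end

/-!
After division by the optimal scalings, an exact Sinkhorn half-step is integration against the
density of the optimal coupling, whose marginals are `α` and `β`. This density is bounded below, so
a half-step contracts the relative oscillation of the scalings (Doeblin minorization), and a step
relaxed by `η` contracts it by `1 - c η`. Replacing the integral by a mean over `B` fresh samples
costs a factor `1 + O(B ^ (-1/2))` in expectation, since by chaining the deviation of the mean is
uniformly small over the Lipschitz functions that occur. With `η_t = t ^ b` and `B_t ~ t ^ (2 a)`,
the resulting recursion `e_t ≤ (1 - c t ^ b) e_{t-1} + M t ^ b t ^ (-a)` has, for `b > -1`, the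
supersolution `K (t + s) ^ (-a)`, and `t(N)` is of order `N ^ (1 / (2 a + 1))`.
-/

noncomputable section

namespace OnlineSinkhorn

section RatioLE

variable {E F ι : Type*}

/-- `h` is positive and all ratios of its values are at most `r`. The logarithm of the best `r` is
`varNorm (log h)`, but the bound on ratios, unlike the logarithm, is stable under sums. -/
structure RatioLE (h : E → ℝ) (r : ℝ) : Prop where
  pos : ∀ z, 0 < h z
  le : ∀ z z', h z ≤ r * h z'

namespace RatioLE

variable {h h' u v : E → ℝ} {r r' ρ η θ δ : ℝ}

lemma of_mem_Icc (hρ : 1 ≤ ρ) (H : ∀ z, h z ∈ Set.Icc ρ⁻¹ ρ) : RatioLE h (ρ ^ 2) where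
  pos z := (inv_pos.2 (by positivity)).trans_le (H z).1
  le z z' := calc
    h z ≤ ρ := (H z).2
    _ = ρ ^ 2 * ρ⁻¹ := by field_simp
    _ ≤ ρ ^ 2 * h z' := by gcongr; exact (H z').1

lemma one_le [Nonempty E] (H : RatioLE h r) : 1 ≤ r := by
  obtain ⟨z⟩ := ‹Nonempty E›
  exact (le_mul_iff_one_le_left (H.pos z)).1 (H.le z z)

lemma mono (H : RatioLE h r) (hr : r ≤ r') : RatioLE h r' where
  pos := H.pos
  le z z' := (H.le z z').trans (mul_le_mul_of_nonneg_right hr (H.pos z').le)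

lemma const_mul (H : RatioLE h r) {c : ℝ} (hc : 0 < c) : RatioLE (fun z => c * h z) r where
  pos z := mul_pos hc (H.pos z)
  le z z' := by linarith [mul_le_mul_of_nonneg_left (H.le z z') hc.le]

lemma inv (H : RatioLE h r) : RatioLE (fun z => (h z)⁻¹) r where
  pos z := inv_pos.2 (H.pos z)
  le z z' := by
    rw [← div_eq_mul_inv, le_div_iff₀ (H.pos z'), inv_mul_le_iff₀ (H.pos z), mul_comm]
    exact H.le z' z

lemma sum {s : Finset ι} (hs : s.Nonempty) {h : ι → E → ℝ} (H : ∀ i ∈ s, RatioLE (h i) r) :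
    RatioLE (fun z => ∑ i ∈ s, h i z) r where
  pos z := Finset.sum_pos (fun i hi => (H i hi).pos z) hs
  le z z' := by
    rw [Finset.mul_sum]
    exact Finset.sum_le_sum fun i hi => (H i hi).le z z'

lemma relax (hu : RatioLE u r) (hv : RatioLE v r) (hη : η ∈ Set.Icc (0 : ℝ) 1) :
    RatioLE (fun z => (1 - η) * u z + η * v z) r where
  pos z := convex_Ioi (0 : ℝ) (hu.pos z) (hv.pos z) (sub_nonneg.2 hη.2) hη.1 (by ring)
  le z z' := by
    linarith [mul_le_mul_of_nonneg_left (hu.le z z') (sub_nonneg.2 hη.2),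
      mul_le_mul_of_nonneg_left (hv.le z z') hη.1]

lemma mul_div_mem_Icc (hv : RatioLE v (ρ ^ 2)) (hρ : 0 < ρ) {a : ℝ} (ha : a ∈ Set.Icc ρ⁻¹ ρ)
    (z z' : E) : v z * (a / v z') ∈ Set.Icc (ρ ^ 3)⁻¹ (ρ ^ 3) := by
  have hz := hv.pos z'
  have ha₀ : 0 < a := (inv_pos.2 hρ).trans_le ha.1
  rw [← mul_div_assoc, Set.mem_Icc, le_div_iff₀ hz, div_le_iff₀ hz]
  constructor
  · calc (ρ ^ 3)⁻¹ * v z' ≤ (ρ ^ 3)⁻¹ * (ρ ^ 2 * v z) := by gcongr; exact hv.le z' z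
      _ = v z * ρ⁻¹ := by field_simp
      _ ≤ v z * a := by have := hv.pos z; gcongr; exact ha.1
  · calc v z * a ≤ ρ ^ 2 * v z' * ρ := mul_le_mul (hv.le z z') ha.2 ha₀.le (by positivity)
      _ = ρ ^ 3 * v z' := by ring

lemma exists_mem_Icc [Nonempty E] (H : RatioLE h r) : ∃ m > 0, ∀ z, h z ∈ Set.Icc m (r * m) := by
  have hr : 0 < r := one_pos.trans_le H.one_le
  have hbdd : BddBelow (Set.range h) := ⟨0, by rintro _ ⟨z, rfl⟩; exact (H.pos z).le⟩
  have hle : ∀ z, h z ≤ r * ⨅ z', h z' := fun z => by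
    rw [← div_le_iff₀' hr]
    exact le_ciInf fun z' => (div_le_iff₀' hr).2 (H.le z z')
  obtain ⟨z⟩ := ‹Nonempty E›
  exact ⟨⨅ z', h z', pos_of_mul_pos_right ((H.pos z).trans_le (hle z)) hr.le,
    fun z => ⟨ciInf_le hbdd z, hle z⟩⟩

lemma integrable [Nonempty E] [MeasurableSpace E] {μ : Measure E} [IsFiniteMeasure μ]
    (H : RatioLE h r) (hm : Measurable h) : Integrable h μ := by
  obtain ⟨m, -, hmem⟩ := H.exists_mem_Icc
  exact Integrable.of_mem_Icc _ _ hm.aemeasurable (.of_forall hmem)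

lemma integral [MeasurableSpace F] {μ : Measure F} [NeZero μ] {k : E → F → ℝ}
    (hk : ∀ y, RatioLE (fun x => k x y) r) (hki : ∀ x, Integrable (k x) μ) :
    RatioLE (fun x => ∫ y, k x y ∂μ) r where
  pos x := by
    rw [integral_pos_iff_support_of_nonneg (fun y => ((hk y).pos x).le) (hki x)]
    have : Function.support (k x) = Set.univ := Set.eq_univ_of_forall fun y => ((hk y).pos x).ne'
    simpa [this] using NeZero.ne μ
  le x x' := by
    rw [← integral_const_mul]
    exact integral_mono (hki x) ((hki x').const_mul r) fun y => (hk y).le x x'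

end RatioLE

lemma varNorm_le_of_forall_sub_le [Nonempty E] {h : E → ℝ} {r : ℝ}
    (H : ∀ z z', h z - h z' ≤ r) : varNorm h ≤ r := by
  rw [varNorm, sub_le_iff_le_add]
  refine ciSup_le fun z => ?_
  rw [← sub_le_iff_le_add']
  exact le_ciInf fun z' => by linarith [H z z']

lemma RatioLE.varNorm_neg_log_le [Nonempty E] {h : E → ℝ} {θ : ℝ} (H : RatioLE h (1 + θ)) :
    varNorm (fun z => -Real.log (h z)) ≤ θ := by
  refine varNorm_le_of_forall_sub_le fun z z' => ?_
  have hθ : 0 < 1 + θ := one_pos.trans_le H.one_le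
  have hlog := Real.log_le_log (H.pos z') (H.le z' z)
  rw [Real.log_mul hθ.ne' (H.pos z).ne'] at hlog
  linarith [Real.log_le_sub_one_of_pos hθ]

/-- Subtracting its lower bound `δ` from a Markov density leaves a density of mass `1 - δ`. -/
lemma integral_mul_sub_mem_Icc [MeasurableSpace F] {μ : Measure F} [IsProbabilityMeasure μ]
    {q H : F → ℝ} {δ m M : ℝ} (hq : ∀ y, δ ≤ q y) (hqi : Integrable q μ) (hq₁ : ∫ y, q y ∂μ = 1)
    (hH : ∀ y, H y ∈ Set.Icc m M) (hHi : Integrable H μ)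
    (hqH : Integrable (fun y => q y * H y) μ) :
    ∫ y, q y * H y ∂μ - δ * ∫ y, H y ∂μ ∈ Set.Icc ((1 - δ) * m) ((1 - δ) * M) := by
  have hrest : ∫ y, q y * H y ∂μ - δ * ∫ y, H y ∂μ = ∫ y, (q y - δ) * H y ∂μ := by
    simp only [sub_mul]
    rw [integral_sub hqH (hHi.const_mul δ), integral_const_mul]
  have hmass : ∀ c, ∫ y, (q y - δ) * c ∂μ = (1 - δ) * c := fun c => by
    rw [integral_mul_const, integral_sub hqi (integrable_const δ), hq₁]
    simp
  have hconst : ∀ c, Integrable (fun y => (q y - δ) * c) μ := fun c =>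
    (hqi.sub (integrable_const δ)).mul_const c
  have hint : Integrable (fun y => (q y - δ) * H y) μ := by
    simp only [sub_mul]
    exact hqH.sub (hHi.const_mul δ)
  rw [hrest, ← hmass m, ← hmass M]
  exact ⟨integral_mono (hconst m) hint fun y =>
      mul_le_mul_of_nonneg_left (hH y).1 (sub_nonneg.2 (hq y)),
    integral_mono hint (hconst M) fun y =>
      mul_le_mul_of_nonneg_left (hH y).2 (sub_nonneg.2 (hq y))⟩

namespace RatioLE

lemma integral_markov [Nonempty F] [MeasurableSpace F] {μ : Measure F} [IsProbabilityMeasure μ]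
    {k : E → F → ℝ} {H : F → ℝ} {δ θ : ℝ} (hδ : 0 < δ) (hk : ∀ x y, δ ≤ k x y)
    (hki : ∀ x, Integrable (k x) μ) (hk₁ : ∀ x, ∫ y, k x y ∂μ = 1)
    (hH : RatioLE H (1 + θ)) (hHi : Integrable H μ)
    (hkH : ∀ x, Integrable (fun y => k x y * H y) μ) :
    RatioLE (fun x => ∫ y, k x y * H y ∂μ) (1 + (1 - δ) * θ) := by
  obtain ⟨m, hm, hmem⟩ := hH.exists_mem_Icc
  have hθ : 0 ≤ θ := by linarith [hH.one_le]
  have hrest := fun x => integral_mul_sub_mem_Icc (hk x) (hki x) (hk₁ x) hmem hHi (hkH x)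
  have hmean : m ≤ ∫ y, H y ∂μ := by
    simpa using integral_mono (integrable_const m) hHi fun y => (hmem y).1
  have hlow : ∀ x, m ≤ ∫ y, k x y * H y ∂μ := fun x => by
    linarith [(hrest x).1, mul_le_mul_of_nonneg_left hmean hδ.le]
  refine ⟨fun x => hm.trans_le (hlow x), fun x x' => ?_⟩
  have hδ₁ : δ ≤ 1 := by
    simpa [hk₁] using integral_mono (integrable_const δ) (hki x) (hk x)
  linarith [(hrest x).2, (hrest x').1,
    mul_le_mul_of_nonneg_left (hlow x') (mul_nonneg (sub_nonneg.2 hδ₁) hθ)]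

lemma of_abs_sub_le {A A' : E → ℝ} {S φ σ : ℝ} (hA : ∀ z, 0 < A z) (hS : RatioLE A' S)
    (H : RatioLE A' (1 + φ)) (hσ : ∀ z z', |A z - A' z| ≤ σ * A z') :
    RatioLE A (1 + (φ + (1 + S) * σ)) where
  pos := hA
  le z z' := by
    have hz' := H.pos z'
    have hq : A' z / A' z' ≤ 1 + φ := (div_le_iff₀ hz').2 (H.le z z')
    have hqS : A' z / A' z' ≤ S := (div_le_iff₀ hz').2 (hS.le z z')
    have hq₀ : 0 < A' z / A' z' := div_pos (H.pos z) hz'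
    calc A z = A' z / A' z' * A z' + ((A z - A' z) + A' z / A' z' * (A' z' - A z')) := by
          field_simp
          ring
      _ ≤ (1 + φ) * A z' + (σ * A z' + S * (σ * A z')) := by
          have h₁ := (abs_le.1 (hσ z z')).2
          have h₂ : A' z' - A z' ≤ σ * A z' := by linarith [(abs_le.1 (hσ z' z')).1]
          have h₃ : 0 ≤ σ * A z' := (abs_nonneg _).trans (hσ z' z')
          have h₄ := (mul_le_mul_of_nonneg_left h₂ hq₀.le).trans
            (mul_le_mul_of_nonneg_right hqS h₃)
          have := (hA z').le
          gcongr
      _ = _ := by ring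

lemma convexComb {U W : E → ℝ} {η θ δ ζ R : ℝ} (hη : η ∈ Set.Icc (0 : ℝ) 1)
    (hθ : 0 ≤ θ) (hδ : 0 ≤ δ) (hζ : 0 ≤ ζ)
    (hU : RatioLE U (1 + θ)) (hW : RatioLE W (1 + ((1 - δ) * θ + ζ)))
    (hlow : ∀ z, ((1 - η) * U z + η * W z) / R ≤ W z)
    (hup : ∀ z, W z ≤ R * ((1 - η) * U z + η * W z)) :
    RatioLE (fun z => (1 - η) * U z + η * W z) (1 + ((1 - δ / R * η) * θ + η * (R * ζ))) where
  pos z := convex_Ioi (0 : ℝ) (hU.pos z) (hW.pos z) (sub_nonneg.2 hη.2) hη.1 (by ring)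
  le z z' := by
    have hU' := mul_le_mul_of_nonneg_left (hU.le z z') (sub_nonneg.2 hη.2)
    have hW' := mul_le_mul_of_nonneg_left (hW.le z z') hη.1
    have hgain := mul_le_mul_of_nonneg_left (hlow z') (mul_nonneg hη.1 (mul_nonneg hδ hθ))
    have hloss := mul_le_mul_of_nonneg_left (hup z') (mul_nonneg hη.1 hζ)
    linear_combination hU' + hW' + hgain + hloss

end RatioLE

end RatioLE

section relaxedUpdate

variable {E F : Type*}

/-- The average of `φ` over the points `y i`, `n ≤ i < n + m`. -/
def batchMean (φ : F → ℝ) (y : ℕ → F) (n m : ℕ) : ℝ :=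
  (∑ i ∈ Finset.Ico n (n + m), φ (y i)) / m

/-- A relaxed stochastic Sinkhorn step of size `η`: the integral `∫ k (·, y) / v y` that would
replace `u` is estimated on a batch of samples. -/
def relaxedUpdate (k : E → F → ℝ) (η : ℝ) (u : E → ℝ) (v : F → ℝ) (y : ℕ → F) (n m : ℕ)
    (x : E) : ℝ :=
  (1 - η) * u x + η * batchMean (fun y' => k x y' / v y') y n m

variable {k : E → F → ℝ} {u : E → ℝ} {v : F → ℝ} {y y' : ℕ → F} {n m : ℕ} {η ρ r : ℝ}

lemma batchMean_congr {φ : F → ℝ} (h : ∀ i < n + m, y i = y' i) :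
    batchMean φ y n m = batchMean φ y' n m := by
  unfold batchMean
  congr 1
  exact Finset.sum_congr rfl fun i hi => by rw [h i (Finset.mem_Ico.1 hi).2]

lemma mul_batchMean (c : ℝ) (φ : F → ℝ) :
    c * batchMean φ y n m = batchMean (fun y => c * φ y) y n m := by
  rw [batchMean, batchMean, ← Finset.mul_sum, mul_div_assoc]

lemma batchMean_mem_Icc {φ : F → ℝ} {l r : ℝ} (hm : 1 ≤ m) (h : ∀ y, φ y ∈ Set.Icc l r) :
    batchMean φ y n m ∈ Set.Icc l r := by
  have hm' : (0 : ℝ) < m := by exact_mod_cast hm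
  have hl := Finset.card_nsmul_le_sum (Finset.Ico n (n + m)) (fun i => φ (y i)) l fun i _ => (h _).1
  have hr := Finset.sum_le_card_nsmul (Finset.Ico n (n + m)) (fun i => φ (y i)) r fun i _ => (h _).2
  simp only [Nat.card_Ico, Nat.add_sub_cancel_left, nsmul_eq_mul] at hl hr
  exact ⟨(le_div_iff₀' hm').2 hl, (div_le_iff₀' hm').2 hr⟩

lemma RatioLE.batchMean (hm : 1 ≤ m) (hk : ∀ y, RatioLE (fun x => k x y) r) :
    RatioLE (fun x => batchMean (k x) y n m) r := by
  have hm' : (0 : ℝ) < m := by exact_mod_cast hm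
  simp only [OnlineSinkhorn.batchMean, div_eq_inv_mul]
  exact (RatioLE.sum (Finset.nonempty_Ico.2 (by omega)) fun i _ => hk (y i)).const_mul
    (inv_pos.2 hm')

lemma RatioLE.relaxedUpdate (hm : 1 ≤ m) (hη : η ∈ Set.Icc (0 : ℝ) 1)
    (hk : ∀ y, RatioLE (fun x => k x y) r) (hv : ∀ y, 0 < v y) (hu : RatioLE u r) :
    RatioLE (relaxedUpdate k η u v y n m) r := by
  refine hu.relax (RatioLE.batchMean hm fun y => ?_) hη
  simpa only [div_eq_inv_mul] using (hk y).const_mul (inv_pos.2 (hv y))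

lemma relaxedUpdate_congr (h : ∀ i < n + m, y i = y' i) :
    relaxedUpdate k η u v y n m = relaxedUpdate k η u v y' n m := by
  funext x
  rw [relaxedUpdate, relaxedUpdate, batchMean_congr h]

lemma continuous_relaxedUpdate {T : Type*} [TopologicalSpace T] [TopologicalSpace E]
    [TopologicalSpace F] {u : T → E → ℝ} {v : T → F → ℝ} {y : T → ℕ → F}
    (hk : Continuous (Function.uncurry k)) (hu : Continuous (Function.uncurry u))
    (hv : Continuous (Function.uncurry v)) (hv₀ : ∀ t y, v t y ≠ 0)
    (hy : ∀ i, Continuous fun t => y t i) :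
    Continuous fun p : T × E => relaxedUpdate k η (u p.1) (v p.1) (y p.1) n m p.2 := by
  have hy' : ∀ i, Continuous fun p : T × E => y p.1 i := fun i => (hy i).comp continuous_fst
  unfold relaxedUpdate batchMean
  refine (hu.const_mul _).add (((continuous_finsetSum _ fun i _ => ?_).div_const _).const_mul _)
  exact (hk.comp (continuous_snd.prodMk (hy' i))).div (hv.comp (continuous_fst.prodMk (hy' i)))
    fun _ => hv₀ _ _

section bounds

variable (hρ : 1 ≤ ρ) (hk : ∀ x y, k x y ∈ Set.Icc ρ⁻¹ ρ) (hv : RatioLE v (ρ ^ 2)) (hm : 1 ≤ m)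

include hρ hk hv hm

lemma mul_batchMean_mem_Icc (x : E) (z : F) :
    v z * batchMean (fun y => k x y / v y) y n m ∈ Set.Icc (ρ ^ 3)⁻¹ (ρ ^ 3) := by
  rw [mul_batchMean]
  exact batchMean_mem_Icc hm fun y => hv.mul_div_mem_Icc (one_pos.trans_le hρ) (hk x y) z y

lemma mul_relaxedUpdate_mem_Icc (hη : η ∈ Set.Icc (0 : ℝ) 1)
    (huv : η = 1 ∨ ∀ x z, v z * u x ∈ Set.Icc (ρ ^ 3)⁻¹ (ρ ^ 3)) (x : E) (z : F) :
    v z * relaxedUpdate k η u v y n m x ∈ Set.Icc (ρ ^ 3)⁻¹ (ρ ^ 3) := by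
  have hmean := mul_batchMean_mem_Icc hρ hk hv hm (y := y) (n := n) x z
  rcases huv with rfl | huv
  · simpa [relaxedUpdate] using hmean
  · have hcomb := convex_Icc _ _ (huv x z) hmean (sub_nonneg.2 hη.2) hη.1 (by ring)
    rw [smul_eq_mul, smul_eq_mul] at hcomb
    convert hcomb using 1
    rw [relaxedUpdate]
    ring

end bounds

/-- `k x` is a probability density with respect to `μ` for every `x`, bounded between `ρ⁻¹` and
`ρ`. -/
structure IsMarkovDensity [MeasurableSpace F] (k : E → F → ℝ) (μ : Measure F) (ρ : ℝ) : Prop where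
  one_le : 1 ≤ ρ
  mem_Icc : ∀ x y, k x y ∈ Set.Icc ρ⁻¹ ρ
  measurable : ∀ x, Measurable (k x)
  integral_eq_one : ∀ x, ∫ y, k x y ∂μ = 1

namespace IsMarkovDensity

variable [MeasurableSpace F] {μ : Measure F} {σ θ τ : ℝ} {z : F} (hk : IsMarkovDensity k μ ρ)

include hk

lemma pos : 0 < ρ := one_pos.trans_le hk.one_le

lemma ratioLE (y : F) : RatioLE (fun x => k x y) (ρ ^ 2) :=
  .of_mem_Icc hk.one_le fun x => hk.mem_Icc x y

lemma integrable_mul {H : F → ℝ} (hH : Integrable H μ) (x : E) :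
    Integrable (fun y => k x y * H y) μ := by
  refine hH.bdd_mul (c := ρ) (hk.measurable x).aestronglyMeasurable (.of_forall fun y => ?_)
  have hxy := hk.mem_Icc x y
  rw [Real.norm_of_nonneg ((inv_pos.2 hk.pos).le.trans hxy.1)]
  exact hxy.2

variable [IsProbabilityMeasure μ]

lemma integrable_div (hv : RatioLE v r) (hvm : Measurable v) (x : E) :
    Integrable (fun y => k x y / v y) μ := by
  have := nonempty_of_isProbabilityMeasure μ
  exact hk.integrable_mul (hv.inv.integrable hvm.inv) x

lemma ratioLE_integral_div (hv : RatioLE v (1 + θ)) (hvm : Measurable v) :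
    RatioLE (fun x => ∫ y, k x y / v y ∂μ) (1 + (1 - ρ⁻¹) * θ) := by
  have := nonempty_of_isProbabilityMeasure μ
  have hki : ∀ x, Integrable (k x) μ := fun x => by
    simpa using hk.integrable_mul (integrable_const 1) x
  exact RatioLE.integral_markov (inv_pos.2 hk.pos) (fun x y => (hk.mem_Icc x y).1) hki
    hk.integral_eq_one hv.inv (hv.inv.integrable hvm.inv) (hk.integrable_div hv hvm)

lemma ratioLE_batchMean_div (hm : 1 ≤ m) (hv : RatioLE v (ρ ^ 2)) (hvθ : RatioLE v (1 + θ))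
    (hvm : Measurable v)
    (hσ : ∀ x, |v z * (batchMean (fun y => k x y / v y) y n m - ∫ y, k x y / v y ∂μ)| ≤ σ) :
    RatioLE (fun x => batchMean (fun y => k x y / v y) y n m)
      (1 + ((1 - ρ⁻¹) * θ + 2 * ρ ^ 5 * σ)) := by
  rcases isEmpty_or_nonempty E with hE | ⟨⟨x₀⟩⟩
  · exact ⟨isEmptyElim, isEmptyElim⟩
  have hρ := hk.pos
  have hz := hv.pos z
  have hσ₀ : 0 ≤ σ := (abs_nonneg _).trans (hσ x₀)
  have hmean := fun x => mul_batchMean_mem_Icc hk.one_le hk.mem_Icc hv hm (y := y) (n := n) x z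
  have hbar : RatioLE (fun x => ∫ y, k x y / v y ∂μ) (ρ ^ 2) :=
    .integral (fun y => by
      simpa only [div_eq_inv_mul] using (hk.ratioLE y).const_mul (inv_pos.2 (hv.pos y)))
      (hk.integrable_div hv hvm)
  refine (RatioLE.of_abs_sub_le (σ := ρ ^ 3 * σ) (fun x => ?_) hbar
    (hk.ratioLE_integral_div hvθ hvm) fun x x' => ?_).mono ?_
  · exact pos_of_mul_pos_right ((inv_pos.2 (pow_pos hρ 3)).trans_le (hmean x).1) hz.le
  · have hdev := hσ x
    rw [abs_mul, abs_of_pos hz, ← le_div_iff₀' hz] at hdev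
    refine hdev.trans ((div_le_iff₀ hz).2 ?_)
    have hone := (inv_le_iff_one_le_mul₀' (pow_pos hρ 3)).1 (hmean x').1
    linarith [mul_le_mul_of_nonneg_left hone hσ₀]
  · have : (1 + ρ ^ 2) * ρ ^ 3 ≤ 2 * ρ ^ 5 := by
      have := one_le_pow₀ hk.one_le (n := 2)
      nlinarith [pow_pos hρ 3]
    linarith [mul_le_mul_of_nonneg_right this hσ₀]

/-- The constant `ρ⁻¹` of Doeblin's condition is diluted to `ρ⁻¹ / ρ ^ 6` because the relaxed
update mixes `u` and the batch mean with weights that are only comparable up to `ρ ^ 6`. -/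
lemma ratioLE_relaxedUpdate (hm : 1 ≤ m) (hη : η ∈ Set.Icc (0 : ℝ) 1)
    (hv : RatioLE v (ρ ^ 2)) (hvm : Measurable v)
    (hprod : ∀ x, v z * relaxedUpdate k η u v y n m x ∈ Set.Icc (ρ ^ 3)⁻¹ (ρ ^ 3))
    (hσ : ∀ x, |v z * (batchMean (fun y => k x y / v y) y n m - ∫ y, k x y / v y ∂μ)| ≤ σ)
    (hτ : 0 ≤ τ) (huθ : RatioLE u (1 + θ)) (hvθ : RatioLE v (1 + (θ + τ))) :
    RatioLE (relaxedUpdate k η u v y n m)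
      (1 + ((1 - ρ⁻¹ / ρ ^ 6 * η) * θ + η * (ρ ^ 6 * (τ + 2 * ρ ^ 5 * σ)))) := by
  rcases isEmpty_or_nonempty E with hE | hE
  · exact ⟨isEmptyElim, isEmptyElim⟩
  have hρ := hk.pos
  have hz := hv.pos z
  have hσ₀ : 0 ≤ σ := (abs_nonneg _).trans (hσ hE.some)
  have hmean := fun x => mul_batchMean_mem_Icc hk.one_le hk.mem_Icc hv hm (y := y) (n := n) x z
  have hW := (hk.ratioLE_batchMean_div hm hv hvθ hvm hσ).mono
    (r' := 1 + ((1 - ρ⁻¹) * θ + (τ + 2 * ρ ^ 5 * σ)))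
    (by linarith [mul_nonneg (inv_nonneg.2 hρ.le) hτ])
  have hcomparable : ∀ {p q : ℝ}, v z * p ∈ Set.Icc (ρ ^ 3)⁻¹ (ρ ^ 3) →
      v z * q ∈ Set.Icc (ρ ^ 3)⁻¹ (ρ ^ 3) → p ≤ ρ ^ 6 * q := fun {p q} hp hq => by
    refine le_of_mul_le_mul_left ?_ hz
    calc v z * p ≤ ρ ^ 3 := hp.2
      _ = ρ ^ 6 * (ρ ^ 3)⁻¹ := by field_simp
      _ ≤ ρ ^ 6 * (v z * q) := by gcongr; exact hq.1
      _ = v z * (ρ ^ 6 * q) := by ring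
  exact RatioLE.convexComb hη (by linarith [huθ.one_le]) (inv_pos.2 hρ).le (by positivity) huθ hW
    (fun x => (div_le_iff₀' (by positivity)).2 (hcomparable (hprod x) (hmean x)))
    (fun x => hcomparable (hmean x) (hprod x))

end IsMarkovDensity

end relaxedUpdate

lemma sampleCount_zero (n₀ : ℕ) (B : ℕ → ℕ) : sampleCount n₀ B 0 = n₀ := by simp [sampleCount]

lemma sampleCount_succ (n₀ : ℕ) (B : ℕ → ℕ) (t : ℕ) :
    sampleCount n₀ B (t + 1) = sampleCount n₀ B t + B (t + 1) := by
  rw [sampleCount, sampleCount, Finset.sum_Icc_succ_top (by omega), add_assoc]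

/-- Step sizes `η t ∈ [0, 1]`, `t ≥ 1`, and batches, all nonempty, for which the first iteration
forgets the initialization. -/
structure IsSchedule (η : ℕ → ℝ) (n₀ : ℕ) (B : ℕ → ℕ) : Prop where
  step_mem : ∀ t, η (t + 1) ∈ Set.Icc (0 : ℝ) 1
  step_one : η 1 = 1
  one_le_batch : ∀ t, 1 ≤ B (t + 1)
  one_le_init : 1 ≤ n₀

section scalings

variable {E : Type*}

/-- The alternating relaxed stochastic Sinkhorn iteration for the kernel `k`, run on the samples
`γ (inl i)` (first variable) and `γ (inr i)` (second variable). The two streams are stored in one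
family so that independence is that of a single family. -/
def scalings (k : E → E → ℝ) (a b : E → ℝ) (η : ℕ → ℝ) (n₀ : ℕ) (B : ℕ → ℕ) (γ : ℕ ⊕ ℕ → E) :
    ℕ → (E → ℝ) × (E → ℝ)
  | 0 => (fun z => ∑ i ∈ Finset.range n₀, a (γ (.inr i)) * k z (γ (.inr i)),
      fun z => ∑ i ∈ Finset.range n₀, b (γ (.inl i)) * k (γ (.inl i)) z)
  | t + 1 =>
    let s := scalings k a b η n₀ B γ t
    let n := sampleCount n₀ B t
    let u := relaxedUpdate k (η (t + 1)) s.1 s.2 (γ ∘ .inr) n (B (t + 1))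
    (u, relaxedUpdate (fun y x => k x y) (η (t + 1)) s.2 u (γ ∘ .inl) n (B (t + 1)))

variable {k : E → E → ℝ} {a b : E → ℝ} {η : ℕ → ℝ} {n₀ : ℕ} {B : ℕ → ℕ} {γ : ℕ ⊕ ℕ → E} {ρ : ℝ}

lemma scalings_fst_succ (t : ℕ) : (scalings k a b η n₀ B γ (t + 1)).1 =
    relaxedUpdate k (η (t + 1)) (scalings k a b η n₀ B γ t).1 (scalings k a b η n₀ B γ t).2
      (γ ∘ .inr) (sampleCount n₀ B t) (B (t + 1)) := rfl

lemma scalings_snd_succ (t : ℕ) : (scalings k a b η n₀ B γ (t + 1)).2 =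
    relaxedUpdate (fun y x => k x y) (η (t + 1)) (scalings k a b η n₀ B γ t).2
      (scalings k a b η n₀ B γ (t + 1)).1 (γ ∘ .inl) (sampleCount n₀ B t) (B (t + 1)) := rfl

lemma dependsOn_scalings_fst_succ_of {t : ℕ} {s : Set (ℕ ⊕ ℕ)}
    (h : DependsOn (fun γ => scalings k a b η n₀ B γ t) s)
    (hs : ∀ i < sampleCount n₀ B (t + 1), .inr i ∈ s) :
    DependsOn (fun γ => (scalings k a b η n₀ B γ (t + 1)).1) s := fun γ γ' hγ => by
  have hst := h hγ
  simp only at hst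
  simp only [scalings_fst_succ, hst]
  exact relaxedUpdate_congr fun i hi => hγ _ (hs i (sampleCount_succ n₀ B t ▸ hi))

lemma dependsOn_scalings (t : ℕ) : DependsOn (fun γ => scalings k a b η n₀ B γ t)
    ((Finset.range (sampleCount n₀ B t)).disjSum (Finset.range (sampleCount n₀ B t)) :
      Set (ℕ ⊕ ℕ)) := by
  induction t with
  | zero =>
    intro γ γ' hγ
    simp only [sampleCount_zero, Finset.mem_coe, Finset.mem_disjSum, Finset.mem_range] at hγ
    have hl : ∀ i ∈ Finset.range n₀, γ (.inl i) = γ' (.inl i) := fun i hi =>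
      hγ _ (by simpa using hi)
    have hr : ∀ i ∈ Finset.range n₀, γ (.inr i) = γ' (.inr i) := fun i hi =>
      hγ _ (by simpa using hi)
    simp only [scalings]
    congr! 2
    · exact Finset.sum_congr rfl fun i hi => by rw [hr i hi]
    · exact Finset.sum_congr rfl fun i hi => by rw [hl i hi]
  | succ t ih =>
    have hle : sampleCount n₀ B t ≤ sampleCount n₀ B (t + 1) := by rw [sampleCount_succ]; omega
    have hst := ih.mono (t := ((Finset.range (sampleCount n₀ B (t + 1))).disjSum
      (Finset.range (sampleCount n₀ B (t + 1))) : Set (ℕ ⊕ ℕ)))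
      (Finset.coe_subset.2 (Finset.disjSum_mono (by simpa) (by simpa)))
    have hfst := dependsOn_scalings_fst_succ_of hst fun i hi => by simpa using hi
    intro γ γ' hγ
    have hγt := hst hγ
    simp only at hγt
    refine Prod.ext (hfst hγ) ?_
    simp only [scalings_snd_succ, hγt, hfst hγ]
    exact relaxedUpdate_congr fun i hi =>
      hγ _ (by simpa [sampleCount_succ] using hi)

lemma dependsOn_scalings_fst_succ (t : ℕ) :
    DependsOn (fun γ => (scalings k a b η n₀ B γ (t + 1)).1)
      ((Finset.range (sampleCount n₀ B t)).disjSum (Finset.range (sampleCount n₀ B (t + 1))) :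
        Set (ℕ ⊕ ℕ)) :=
  dependsOn_scalings_fst_succ_of ((dependsOn_scalings t).mono (Finset.coe_subset.2
    (Finset.disjSum_mono le_rfl (by simp [sampleCount_succ])))) fun i hi => by simpa using hi

section bounds

variable (hs : IsSchedule η n₀ B) (hρ : 1 ≤ ρ) (hk : ∀ x y, k x y ∈ Set.Icc ρ⁻¹ ρ)
  (ha : ∀ y, 0 < a y) (hb : ∀ x, 0 < b x)

include hs hρ hk ha hb

lemma ratioLE_scalings (t : ℕ) : RatioLE (scalings k a b η n₀ B γ t).1 (ρ ^ 2) ∧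
    RatioLE (scalings k a b η n₀ B γ t).2 (ρ ^ 2) := by
  have hk₁ : ∀ y, RatioLE (fun x => k x y) (ρ ^ 2) := fun y => .of_mem_Icc hρ fun x => hk x y
  have hk₂ : ∀ x, RatioLE (fun y => k x y) (ρ ^ 2) := fun x => .of_mem_Icc hρ (hk x)
  induction t with
  | zero =>
    have hn : (Finset.range n₀).Nonempty :=
      Finset.nonempty_range_iff.2 (Nat.one_le_iff_ne_zero.1 hs.one_le_init)
    exact ⟨.sum hn fun i _ => (hk₁ _).const_mul (ha _), .sum hn fun i _ => (hk₂ _).const_mul (hb _)⟩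
  | succ t ih =>
    have hfst : RatioLE (scalings k a b η n₀ B γ (t + 1)).1 (ρ ^ 2) :=
      .relaxedUpdate (hs.one_le_batch t) (hs.step_mem t) hk₁ ih.2.pos ih.1
    exact ⟨hfst, .relaxedUpdate (hs.one_le_batch t) (hs.step_mem t) hk₂ hfst.pos ih.2⟩

/-- The step `η 1 = 1` removes the dependence of the products on the number of initial samples. -/
lemma scalings_mul_mem_Icc (t : ℕ) :
    (∀ x z, (scalings k a b η n₀ B γ t).2 z * (scalings k a b η n₀ B γ (t + 1)).1 x ∈
      Set.Icc (ρ ^ 3)⁻¹ (ρ ^ 3)) ∧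
    ∀ x z, (scalings k a b η n₀ B γ (t + 1)).1 z * (scalings k a b η n₀ B γ (t + 1)).2 x ∈
      Set.Icc (ρ ^ 3)⁻¹ (ρ ^ 3) := by
  have hratio := ratioLE_scalings (γ := γ) hs hρ hk ha hb
  have hsecond : ∀ t, (η (t + 1) = 1 ∨ ∀ x z, (scalings k a b η n₀ B γ t).2 z *
      (scalings k a b η n₀ B γ (t + 1)).1 x ∈ Set.Icc (ρ ^ 3)⁻¹ (ρ ^ 3)) →
      ∀ x z, (scalings k a b η n₀ B γ (t + 1)).1 z * (scalings k a b η n₀ B γ (t + 1)).2 x ∈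
        Set.Icc (ρ ^ 3)⁻¹ (ρ ^ 3) := fun t ht =>
    mul_relaxedUpdate_mem_Icc hρ (fun y x => hk x y) (hratio (t + 1)).1 (hs.one_le_batch t)
      (hs.step_mem t) (ht.imp_right fun h x z => by simpa only [mul_comm] using h z x)
  induction t with
  | zero =>
    exact ⟨mul_relaxedUpdate_mem_Icc hρ hk (hratio 0).2 (hs.one_le_batch 0) (hs.step_mem 0)
      (.inl hs.step_one), hsecond 0 (.inl hs.step_one)⟩
  | succ t ih =>
    have hfirst := mul_relaxedUpdate_mem_Icc hρ hk (hratio (t + 1)).2 (hs.one_le_batch (t + 1))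
      (hs.step_mem (t + 1)) (y := γ ∘ .inr) (n := sampleCount n₀ B (t + 1))
      (.inr fun x z => by simpa only [mul_comm] using ih.2 z x)
    exact ⟨hfirst, hsecond (t + 1) (.inr hfirst)⟩

lemma continuous_scalings [TopologicalSpace E] (hkc : Continuous (Function.uncurry k))
    (hac : Continuous a) (hbc : Continuous b) (t : ℕ) :
    (Continuous fun p : (ℕ ⊕ ℕ → E) × E => (scalings k a b η n₀ B p.1 t).1 p.2) ∧
      Continuous fun p : (ℕ ⊕ ℕ → E) × E => (scalings k a b η n₀ B p.1 t).2 p.2 := by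
  have hγ : ∀ j, Continuous fun p : (ℕ ⊕ ℕ → E) × E => p.1 j := fun j => by fun_prop
  have hratio := fun γ : ℕ ⊕ ℕ → E => ratioLE_scalings (γ := γ) hs hρ hk ha hb
  induction t with
  | zero =>
    simp only [scalings]
    exact ⟨continuous_finsetSum _ fun i _ =>
        (hac.comp (hγ (.inr i))).mul (hkc.comp (continuous_snd.prodMk (hγ (.inr i)))),
      continuous_finsetSum _ fun i _ =>
        (hbc.comp (hγ (.inl i))).mul (hkc.comp ((hγ (.inl i)).prodMk continuous_snd))⟩
  | succ t ih =>
    have hfst : Continuous fun p : (ℕ ⊕ ℕ → E) × E =>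
        (scalings k a b η n₀ B p.1 (t + 1)).1 p.2 := by
      simp only [scalings_fst_succ]
      exact continuous_relaxedUpdate (u := fun γ => (scalings k a b η n₀ B γ t).1)
        (v := fun γ => (scalings k a b η n₀ B γ t).2) (y := fun γ => γ ∘ Sum.inr) hkc ih.1 ih.2
        (fun γ z => ((hratio γ t).2.pos z).ne') fun i => continuous_apply (A := fun _ => E) _
    refine ⟨hfst, ?_⟩
    simp only [scalings_snd_succ]
    exact continuous_relaxedUpdate (k := fun y x => k x y)
      (u := fun γ => (scalings k a b η n₀ B γ t).2)
      (v := fun γ => (scalings k a b η n₀ B γ (t + 1)).1) (y := fun γ => γ ∘ Sum.inl)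
      (hkc.comp continuous_swap) ih.2 hfst (fun γ z => ((hratio γ (t + 1)).1.pos z).ne')
      fun i => continuous_apply (A := fun _ => E) _

end bounds

end scalings

section weights

variable {E : Type*} {ε : ℝ} {C : E → E → ℝ} {f g : E → ℝ} {η : ℕ → ℝ} {n₀ : ℕ} {B : ℕ → ℕ}
  {γ : ℕ ⊕ ℕ → E} {ρ : ℝ}

/-- The density, with respect to the product of the marginals, of the coupling attached to the
potentials `f` and `g`. -/
def couplingDensity (ε : ℝ) (C : E → E → ℝ) (f g : E → ℝ) (x y : E) : ℝ :=
  Real.exp ((f x + g y - C x y) / ε)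

/-- The iterates `exp ((f - f_t) / ε)` and `exp ((g - g_t) / ε)` of online Sinkhorn, normalized by
reference potentials `f` and `g`. They solve the same recursion as the unnormalized ones, with the
kernel `exp (-C / ε)` replaced by the coupling density. -/
def normalizedScalings (ε : ℝ) (C : E → E → ℝ) (f g : E → ℝ) : (η : ℕ → ℝ) → (n₀ : ℕ) →
    (B : ℕ → ℕ) → (γ : ℕ ⊕ ℕ → E) → ℕ → (E → ℝ) × (E → ℝ) :=
  scalings (couplingDensity ε C f g) (fun y => Real.exp (-g y / ε)) fun x => Real.exp (-f x / ε)

lemma weights_q_succ {x y : ℕ → E} (t : ℕ) : (weights ε C η n₀ B x y (t + 1)).q =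
    updateWeights ε (η (t + 1)) (sampleCount n₀ B t) (B (t + 1)) (weights ε C η n₀ B x y t).q
      fun i => potentialG ε C η n₀ B x y t (y i) := rfl

lemma weights_p_succ {x y : ℕ → E} (t : ℕ) : (weights ε C η n₀ B x y (t + 1)).p =
    updateWeights ε (η (t + 1)) (sampleCount n₀ B t) (B (t + 1)) (weights ε C η n₀ B x y t).p
      fun i => potentialF ε C η n₀ B x y (t + 1) (x i) := by
  simp only [potentialF, sampleCount_succ]
  rfl

lemma weightedPotential_eq (hε : ε ≠ 0) {n : ℕ} {w : ℕ → ℝ} {y : ℕ → E} {z : E} {u : ℝ}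
    (hu : 0 < u) (h : ∑ i ∈ Finset.range n, w i * Real.exp (-C z (y i) / ε)
      = Real.exp (-f z / ε) * u) :
    weightedPotential ε C n w y z = f z - ε * Real.log u := by
  rw [weightedPotential, h, Real.log_mul (Real.exp_ne_zero _) hu.ne', Real.log_exp]
  field_simp
  ring

lemma sum_updateWeights_mul {η c : ℝ} {n m : ℕ} {w h : ℕ → ℝ} {φ : E → ℝ} {y : ℕ → E}
    {k : E → E → ℝ} {u v : E → ℝ} {z : E}
    (hold : ∑ i ∈ Finset.range n, w i * φ (y i) = c * u z)
    (hnew : ∀ i, Real.exp (h i / ε) * φ (y i) = c * (k z (y i) / v (y i))) :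
    ∑ i ∈ Finset.range (n + m), updateWeights ε η n m w h i * φ (y i)
      = c * relaxedUpdate k η u v y n m z := by
  have hlow : ∀ i ∈ Finset.range n, updateWeights ε η n m w h i * φ (y i)
      = (1 - η) * (w i * φ (y i)) := fun i hi => by
    rw [updateWeights, if_pos (Finset.mem_range.1 hi), mul_assoc]
  have hhigh : ∀ i ∈ Finset.Ico n (n + m), updateWeights ε η n m w h i * φ (y i)
      = η / m * c * (k z (y i) / v (y i)) := fun i hi => by
    obtain ⟨h₁, h₂⟩ := Finset.mem_Ico.1 hi
    rw [updateWeights, if_neg h₁.not_gt, if_pos h₂, mul_assoc, hnew, mul_assoc]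
  rw [← Finset.sum_range_add_sum_Ico _ (Nat.le_add_right n m), Finset.sum_congr rfl hlow,
    Finset.sum_congr rfl hhigh, ← Finset.mul_sum, ← Finset.mul_sum, hold, relaxedUpdate, batchMean]
  ring

lemma exp_weightedPotential_mul (hε : ε ≠ 0) {n : ℕ} {w : ℕ → ℝ} {y : ℕ → E} {z : E} {u : ℝ}
    (hu : 0 < u) (h : ∑ i ∈ Finset.range n, w i * Real.exp (-C z (y i) / ε)
      = Real.exp (-f z / ε) * u) (c r : ℝ) :
    Real.exp (weightedPotential ε C n w y z / ε) * Real.exp (-c / ε)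
      = Real.exp (-r / ε) * (Real.exp ((f z + r - c) / ε) / u) := by
  rw [weightedPotential_eq hε hu h, sub_div, mul_div_cancel_left₀ _ hε, Real.exp_sub,
    Real.exp_log hu, div_mul_eq_mul_div, mul_div_assoc', ← Real.exp_add, ← Real.exp_add]
  congr 2
  ring

section

variable (hε : ε ≠ 0) (hs : IsSchedule η n₀ B) (hρ : 1 ≤ ρ)
  (hk : ∀ x y, couplingDensity ε C f g x y ∈ Set.Icc ρ⁻¹ ρ)

include hs hρ hk

lemma ratioLE_normalizedScalings (t : ℕ) :
    RatioLE (normalizedScalings ε C f g η n₀ B γ t).1 (ρ ^ 2) ∧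
      RatioLE (normalizedScalings ε C f g η n₀ B γ t).2 (ρ ^ 2) :=
  ratioLE_scalings hs hρ hk (fun y => Real.exp_pos (-g y / ε)) (fun x => Real.exp_pos (-f x / ε)) t

include hε

lemma sum_weights_mul_eq_normalizedScalings (t : ℕ) :
    (∀ z, ∑ i ∈ Finset.range (sampleCount n₀ B t),
      (weights ε C η n₀ B (γ ∘ .inl) (γ ∘ .inr) t).q i * Real.exp (-C z ((γ ∘ .inr) i) / ε)
        = Real.exp (-f z / ε) * (normalizedScalings ε C f g η n₀ B γ t).1 z) ∧
    ∀ z, ∑ i ∈ Finset.range (sampleCount n₀ B t),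
      (weights ε C η n₀ B (γ ∘ .inl) (γ ∘ .inr) t).p i * Real.exp (-C ((γ ∘ .inl) i) z / ε)
        = Real.exp (-g z / ε) * (normalizedScalings ε C f g η n₀ B γ t).2 z := by
  have hpos := ratioLE_normalizedScalings (γ := γ) hs hρ hk
  unfold normalizedScalings at hpos ⊢
  induction t with
  | zero =>
    simp only [sampleCount_zero, weights, scalings, Function.comp_apply, couplingDensity,
      Finset.mul_sum, ← Real.exp_add]
    refine ⟨fun z => Finset.sum_congr rfl fun i hi => ?_,
      fun z => Finset.sum_congr rfl fun i hi => ?_⟩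
    all_goals
      rw [if_pos (Finset.mem_range.1 hi), one_mul]
      congr 1
      ring
  | succ t ih =>
    have hfst : ∀ z, ∑ i ∈ Finset.range (sampleCount n₀ B (t + 1)),
        (weights ε C η n₀ B (γ ∘ .inl) (γ ∘ .inr) (t + 1)).q i * Real.exp (-C z ((γ ∘ .inr) i) / ε)
          = Real.exp (-f z / ε) * (scalings (couplingDensity ε C f g) (fun y => Real.exp (-g y / ε))
            (fun x => Real.exp (-f x / ε)) η n₀ B γ (t + 1)).1 z := fun z => by
      rw [sampleCount_succ, weights_q_succ, scalings_fst_succ]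
      refine sum_updateWeights_mul (φ := fun y => Real.exp (-C z y / ε)) (ih.1 z) fun i => ?_
      rw [potentialG, exp_weightedPotential_mul (C := fun y x => C x y) hε ((hpos t).2.pos _)
        (ih.2 _) _ (f z), add_comm, couplingDensity]
    refine ⟨hfst, fun z => ?_⟩
    rw [sampleCount_succ, weights_p_succ, scalings_snd_succ]
    refine sum_updateWeights_mul (φ := fun x => Real.exp (-C x z / ε)) (ih.2 z) fun i => ?_
    exact exp_weightedPotential_mul hε ((hpos (t + 1)).1.pos _) (hfst _) _ (g z)

lemma potentialError_eq (t : ℕ) :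
    potentialError ε C η n₀ B f g (γ ∘ .inl) (γ ∘ .inr) t =
      varNorm (fun z => -Real.log ((normalizedScalings ε C f g η n₀ B γ t).1 z)) +
        varNorm (fun z => -Real.log ((normalizedScalings ε C f g η n₀ B γ t).2 z)) := by
  have hpos := ratioLE_normalizedScalings (γ := γ) hs hρ hk t
  have hsum := sum_weights_mul_eq_normalizedScalings (γ := γ) hε hs hρ hk t
  have hF : ∀ z, potentialF ε C η n₀ B (γ ∘ .inl) (γ ∘ .inr) t z = _ := fun z =>
    weightedPotential_eq hε (hpos.1.pos z) (hsum.1 z)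
  have hG : ∀ z, potentialG ε C η n₀ B (γ ∘ .inl) (γ ∘ .inr) t z = _ := fun z =>
    weightedPotential_eq (C := fun y x => C x y) hε (hpos.2.pos z) (hsum.2 z)
  simp only [potentialError, hF, hG, sub_sub_cancel_left, neg_div, mul_div_cancel_left₀ _ hε]

end

end weights

section ExpectedSup

variable {Ω ι κ : Type*} [MeasurableSpace Ω] {P : Measure Ω} {s : Set ι} {s' : Set κ}
  {W : ι → Ω → ℝ} {D : κ → Ω → ℝ} {c c' : ℝ}

/-- The process `|W|` is dominated on `s` by an integrable random variable of mean at most `c`.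
This says `E[sup_{i ∈ s} |W i|] ≤ c` without asking for the measurability of an uncountable
supremum. -/
def ExpectedSupLE (P : Measure Ω) (s : Set ι) (W : ι → Ω → ℝ) (c : ℝ) : Prop :=
  ∃ σ : Ω → ℝ, Integrable σ P ∧ (∀ i ∈ s, ∀ ω, |W i ω| ≤ σ ω) ∧ ∫ ω, σ ω ∂P ≤ c

lemma ExpectedSupLE.mono (hW : ExpectedSupLE P s W c) (hc : c ≤ c') : ExpectedSupLE P s W c' :=
  let ⟨σ, hσ, hWσ, hσc⟩ := hW
  ⟨σ, hσ, hWσ, hσc.trans hc⟩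

lemma expectedSupLE_of_forall_abs_le [IsProbabilityMeasure P]
    (h : ∀ i ∈ s, ∀ ω, |W i ω| ≤ c) : ExpectedSupLE P s W c :=
  ⟨fun _ => c, integrable_const c, h, by simp⟩

lemma ExpectedSupLE.of_abs_le_add {τ : Type*} {u : Set τ} {Z : τ → Ω → ℝ}
    (hW : ExpectedSupLE P s W c) (hD : ExpectedSupLE P s' D c')
    (h : ∀ k ∈ u, ∃ i ∈ s, ∃ j ∈ s', ∀ ω, |Z k ω| ≤ |W i ω| + |D j ω|) :
    ExpectedSupLE P u Z (c + c') := by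
  obtain ⟨σ, hσ, hWσ, hσc⟩ := hW
  obtain ⟨τ, hτ, hDτ, hτc⟩ := hD
  refine ⟨fun ω => σ ω + τ ω, hσ.add hτ, fun k hk ω => ?_, ?_⟩
  · obtain ⟨i, hi, j, hj, hle⟩ := h k hk
    exact (hle ω).trans (add_le_add (hWσ i hi ω) (hDτ j hj ω))
  · rw [integral_add hσ hτ]
    exact add_le_add hσc hτc

end ExpectedSup

section SubGaussian

variable {Ω : Type*} [MeasurableSpace Ω] {P : Measure Ω}

lemma integral_exp_mul_abs_le_of_hasSubgaussianMGF {Y : Ω → ℝ} {v : ℝ≥0}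
    (hY : HasSubgaussianMGF Y v P) (t : ℝ) :
    ∫ ω, Real.exp (t * |Y ω|) ∂P ≤ 2 * Real.exp (v * t ^ 2 / 2) := by
  calc ∫ ω, Real.exp (t * |Y ω|) ∂P
      ≤ ∫ ω, (Real.exp (t * Y ω) + Real.exp (-t * Y ω)) ∂P :=
        integral_mono
          (integrable_exp_mul_abs (hY.integrable_exp_mul t) (hY.integrable_exp_mul (-t)))
          ((hY.integrable_exp_mul t).add (hY.integrable_exp_mul (-t)))
          fun ω => by
            rcases abs_choice (Y ω) with h | h <;> rw [h]
            · exact le_add_of_nonneg_right (Real.exp_pos _).le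
            · rw [← neg_mul_comm]
              exact le_add_of_nonneg_left (Real.exp_pos _).le
    _ = mgf Y P t + mgf Y P (-t) :=
        integral_add (hY.integrable_exp_mul t) (hY.integrable_exp_mul (-t))
    _ ≤ 2 * Real.exp (v * t ^ 2 / 2) := by
        have hneg := hY.mgf_le (-t)
        rw [neg_sq] at hneg
        linarith [hY.mgf_le t]

lemma expectedSupLE_of_card_le [IsProbabilityMeasure P] {ι : Type*} {F : Finset ι} {n : ℕ}
    (hn : 1 ≤ n) (hF : F.card ≤ n) {W : ι → Ω → ℝ} {v : ℝ≥0}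
    (hW : ∀ i ∈ F, HasSubgaussianMGF (W i) v P) {t : ℝ} (ht : 0 < t) :
    ExpectedSupLE P F W (Real.log (2 * n) / t + v * t / 2) := by
  have : (0 : ℝ) < n := by exact_mod_cast hn
  set N : ℝ := 2 * n * Real.exp (v * t ^ 2 / 2) with hN
  have hN0 : 0 < N := by positivity
  have hint := fun i hi => integrable_exp_mul_abs ((hW i hi).integrable_exp_mul t)
    ((hW i hi).integrable_exp_mul (-t))
  have hsum : Integrable (fun ω => (∑ i ∈ F, Real.exp (t * |W i ω|)) / N) P :=
    (integrable_finsetSum F hint).div_const N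
  refine ⟨fun ω => ((∑ i ∈ F, Real.exp (t * |W i ω|)) / N + (Real.log N - 1)) / t,
    (hsum.add (integrable_const _)).div_const t, fun i hi ω => ?_, ?_⟩
  · have hsingle : Real.exp (t * |W i ω|) ≤ ∑ i ∈ F, Real.exp (t * |W i ω|) :=
      Finset.single_le_sum (f := fun i => Real.exp (t * |W i ω|))
        (fun _ _ => (Real.exp_pos _).le) hi
    -- The tangent of `log` at `N` takes the place of Jensen's inequality.
    have hlog := Real.log_le_sub_one_of_pos (div_pos (Real.exp_pos (t * |W i ω|)) hN0)
    rw [Real.log_div (Real.exp_pos _).ne' hN0.ne', Real.log_exp] at hlog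
    rw [le_div_iff₀' ht]
    linarith [div_le_div_of_nonneg_right hsingle hN0.le]
  · have hmean : ∑ i ∈ F, ∫ ω, Real.exp (t * |W i ω|) ∂P ≤ N :=
      calc _ ≤ ∑ _i ∈ F, 2 * Real.exp (v * t ^ 2 / 2) :=
            Finset.sum_le_sum fun i hi => integral_exp_mul_abs_le_of_hasSubgaussianMGF (hW i hi) t
        _ = F.card * (2 * Real.exp (v * t ^ 2 / 2)) := by rw [Finset.sum_const, nsmul_eq_mul]
        _ ≤ n * (2 * Real.exp (v * t ^ 2 / 2)) := by gcongr
        _ = N := by rw [hN]; ring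
    rw [integral_div, integral_add hsum (integrable_const _), integral_div,
      integral_finsetSum F hint, integral_const, probReal_univ, one_smul]
    have hlogN : Real.log N = Real.log (2 * n) + v * t ^ 2 / 2 := by
      rw [hN, Real.log_mul (by positivity) (Real.exp_ne_zero _), Real.log_exp]
    calc _ ≤ Real.log N / t := by gcongr; linarith [(div_le_one hN0).2 hmean]
      _ = Real.log (2 * n) / t + v * t / 2 := by rw [hlogN]; field_simp

end SubGaussian

section Chaining

variable {Ω E : Type*} [MeasurableSpace Ω] {P : Measure Ω} [IsProbabilityMeasure P]
  [PseudoMetricSpace E] {A : ℕ}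

/-- The covering numbers of `E` at the dyadic scales `2 ^ (-k)` grow at most geometrically, with
ratio `A`: up to constants, `E` has upper box dimension at most `log₂ A`. -/
def HasGeometricCovering (E : Type*) [PseudoMetricSpace E] (A : ℕ) : Prop :=
  ∀ k : ℕ, Metric.coveringNumber ((1 / 2) ^ k) (Set.univ : Set E) ≤ (A ^ (k + 1) : ℕ)

lemma HasGeometricCovering.one_le [Nonempty E] (hA : HasGeometricCovering E A) : 1 ≤ A := by
  have hpos : 0 < Metric.coveringNumber ((1 / 2) ^ 0) (Set.univ : Set E) :=
    Metric.coveringNumber_pos_iff.2 Set.univ_nonempty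
  simpa [Nat.one_le_iff_ne_zero, Nat.pos_iff_ne_zero] using hpos.trans_le (hA 0)

lemma HasGeometricCovering.exists_net (hA : HasGeometricCovering E A) (k : ℕ) :
    ∃ N : Finset E, N.card ≤ A ^ (k + 1) ∧ ∀ x, ∃ p ∈ N, nndist x p ≤ (1 / 2) ^ k := by
  have htop : Metric.coveringNumber ((1 / 2) ^ k) (Set.univ : Set E) ≠ ⊤ :=
    ((hA k).trans_lt (ENat.natCast_lt_top _)).ne
  have hfin := Metric.finite_minimalCover (ε := (1 / 2) ^ k) (A := (Set.univ : Set E))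
  refine ⟨hfin.toFinset, ?_, fun x => ?_⟩
  · have hcard := (Metric.encard_minimalCover htop).trans_le (hA k)
    rw [hfin.encard_eq_coe_toFinset_card] at hcard
    exact_mod_cast hcard
  · obtain ⟨p, hp, hxp⟩ := Metric.isCover_minimalCover htop (Set.mem_univ x)
    exact ⟨p, hfin.mem_toFinset.2 hp, by simpa only [Set.mem_ofPred_eq, edist_nndist,
      ENNReal.coe_le_coe] using hxp⟩

lemma expectedSupLE_level {ι : Type*} {F : Finset ι} (hA : 1 ≤ A) {k : ℕ}
    (hF : F.card ≤ A ^ (k + 1)) {W : ι → Ω → ℝ} {v : ℝ≥0} (hv : 0 < v)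
    (hW : ∀ i ∈ F, HasSubgaussianMGF (W i) (v ^ 2) P) :
    ExpectedSupLE P F W (v * ((k + 1) * Real.log (4 * A))) := by
  have : (1 : ℝ) ≤ A := by exact_mod_cast hA
  refine (expectedSupLE_of_card_le (Nat.one_le_pow _ _ hA) hF hW
    (t := (v : ℝ)⁻¹) (by positivity)).mono ?_
  have hlog : Real.log (2 * (A ^ (k + 1) : ℕ)) = Real.log 2 + (k + 1) * Real.log A := by
    push_cast
    rw [Real.log_mul two_ne_zero (by positivity), Real.log_pow]
    push_cast
    ring
  have hlog4 : Real.log (4 * A) = 2 * Real.log 2 + Real.log A := by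
    rw [Real.log_mul four_ne_zero (by positivity), show (4 : ℝ) = 2 ^ 2 by norm_num, Real.log_pow]
    norm_num
  have hlog2 : 1 / 2 ≤ Real.log 2 := by linarith [Real.log_two_gt_d9]
  rw [hlog, hlog4, div_inv_eq_mul, NNReal.coe_pow,
    show (v : ℝ) ^ 2 * (v : ℝ)⁻¹ / 2 = v * (1 / 2) by field_simp, mul_comm _ (v : ℝ), ← mul_add]
  gcongr
  nlinarith [k.cast_nonneg (α := ℝ)]

/-- Chaining along nets at the scales `2 ^ (-j)`, `j ≤ k`. The first factor of the logarithm is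
`1 + ∑_{j < k} (j + 2) 2 ^ (-j)`. -/
lemma expectedSupLE_net (hA : 1 ≤ A) {N : ℕ → Finset E} (hcard : ∀ k, (N k).card ≤ A ^ (k + 1))
    (hN : ∀ k x, ∃ p ∈ N k, nndist x p ≤ (1 / 2) ^ k) {W : E → Ω → ℝ} {v : ℝ≥0} (hv : 0 < v)
    (hW : ∀ x, HasSubgaussianMGF (W x) (v ^ 2) P)
    (hinc : ∀ x y r, nndist x y ≤ r →
      HasSubgaussianMGF (fun ω => W x ω - W y ω) ((v * r) ^ 2) P) (k : ℕ) :
    ExpectedSupLE P (N k) W (v * ((7 - (2 * k + 6) * (1 / 2) ^ k) * Real.log (4 * A))) := by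
  choose π hπN hπ using hN
  induction k with
  | zero =>
    refine (expectedSupLE_level hA (hcard 0) hv fun x _ => hW x).mono (le_of_eq ?_)
    norm_num
  | succ k ih =>
    have hstep := expectedSupLE_level (P := P) hA (hcard (k + 1))
      (mul_pos hv (pow_pos one_half_pos k))
      (W := fun x ω => W x ω - W (π k x) ω) fun x _ => hinc _ _ _ (hπ k x)
    refine (ih.of_abs_le_add hstep fun x hx => ⟨_, hπN k x, x, hx, fun ω => ?_⟩).mono
      (le_of_eq ?_)
    · linarith [abs_sub_abs_le_abs_sub (W x ω) (W (π k x) ω)]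
    · push_cast
      ring

lemma HasGeometricCovering.expectedSupLE [Nonempty E] (hA : HasGeometricCovering E A)
    {W : E → Ω → ℝ} {v : ℝ≥0} (hv : 0 < v) (hW : ∀ x, HasSubgaussianMGF (W x) (v ^ 2) P)
    (hinc : ∀ x y r, nndist x y ≤ r →
      HasSubgaussianMGF (fun ω => W x ω - W y ω) ((v * r) ^ 2) P)
    {K : ℝ≥0} (hLip : ∀ ω, LipschitzWith K fun x => W x ω) :
    ExpectedSupLE P Set.univ W (v * (7 * Real.log (4 * A) + 1)) := by
  choose N hcard hN using hA.exists_net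
  have hlog : 0 ≤ Real.log (4 * A) := Real.log_nonneg (by
    have : (1 : ℝ) ≤ A := by exact_mod_cast hA.one_le
    linarith)
  obtain ⟨k, hk⟩ : ∃ k : ℕ, K * (1 / 2 : ℝ≥0) ^ k ≤ v := by
    have hlim := (NNReal.tendsto_pow_atTop_nhds_zero_of_lt_one one_half_lt_one).const_mul K
    rw [mul_zero] at hlim
    exact (hlim.eventually_le_const hv).exists
  have hnet := expectedSupLE_net hA.one_le hcard hN hv hW hinc k
  choose π hπN hπ using hN
  have hrest : ExpectedSupLE P Set.univ (fun x ω => W x ω - W (π k x) ω) (v : ℝ) :=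
    expectedSupLE_of_forall_abs_le fun x _ ω => by
      have hx : nndist (W x ω) (W (π k x) ω) ≤ v :=
        ((hLip ω).nndist_le x (π k x)).trans ((mul_le_mul_right (hπ k x) K).trans hk)
      exact_mod_cast hx
  refine (hnet.of_abs_le_add hrest fun x _ => ⟨_, hπN k x, x, trivial, fun ω => ?_⟩).mono ?_
  · linarith [abs_sub_abs_le_abs_sub (W x ω) (W (π k x) ω)]
  · rw [← mul_add_one]
    gcongr
    exact sub_le_self _ (by positivity)

end Chaining

section Covering

open Metric Pointwise

variable {V : Type*} [NormedAddCommGroup V] [NormedSpace ℝ V]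

lemma isCover_add_smul {T s N : Set V} (hT : IsCover (1 / 2) (closedBall 0 1) T) {r : ℝ≥0}
    (hr : r ≠ 0) (hN : IsCover r s N) : IsCover (r * (1 / 2)) s (N + (r : ℝ) • T) := by
  have hr' : (0 : ℝ) < r := by exact_mod_cast pos_iff_ne_zero.2 hr
  rw [isCover_iff_subset_iUnion_closedBall] at hN hT ⊢
  intro x hx
  obtain ⟨n, hn, hxn⟩ := Set.mem_iUnion₂.1 (hN hx)
  have hunit : (r : ℝ)⁻¹ • (x - n) ∈ closedBall (0 : V) 1 := by
    rw [mem_closedBall_zero_iff, norm_smul, norm_inv, Real.norm_of_nonneg hr'.le,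
      inv_mul_le_one₀ hr', ← dist_eq_norm]
    exact hxn
  obtain ⟨y, hy, hxy⟩ := Set.mem_iUnion₂.1 (hT hunit)
  refine Set.mem_iUnion₂.2 ⟨n + (r : ℝ) • y, Set.add_mem_add hn (Set.smul_mem_smul_set hy), ?_⟩
  have hscale : x - (n + (r : ℝ) • y) = (r : ℝ) • ((r : ℝ)⁻¹ • (x - n) - y) := by
    rw [smul_sub, smul_inv_smul₀ hr'.ne', sub_sub]
  rw [mem_closedBall, dist_eq_norm, hscale, norm_smul, Real.norm_of_nonneg hr'.le, NNReal.coe_mul]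
  gcongr
  rwa [← dist_eq_norm]

lemma exists_isCover_closedBall_card_le {T : Finset V}
    (hT : IsCover (1 / 2) (closedBall (0 : V) 1) (T : Set V)) {R : ℝ≥0} (hR : R ≠ 0) (k : ℕ) :
    ∃ N : Finset V, N.card ≤ T.card ^ k ∧
      IsCover (R * (1 / 2) ^ k) (closedBall 0 R) (N : Set V) := by
  classical
  induction k with
  | zero => exact ⟨{0}, by simp, by simp [isCover_iff_subset_iUnion_closedBall]⟩
  | succ k ih =>
    obtain ⟨N, hcard, hN⟩ := ih
    refine ⟨N + (R * (1 / 2) ^ k : ℝ) • T, ?_, ?_⟩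
    · have hsmul : ((R * (1 / 2) ^ k : ℝ) • T).card ≤ T.card := Finset.card_image_le
      calc _ ≤ N.card * T.card := Finset.card_add_le.trans (by gcongr)
        _ ≤ T.card ^ (k + 1) := by rw [pow_succ]; gcongr
    · have hcover := isCover_add_smul hT (mul_ne_zero hR (pow_ne_zero k (by norm_num))) hN
      rw [mul_assoc, ← pow_succ] at hcover
      simpa using hcover

lemma exists_hasGeometricCovering [ProperSpace V] {X : Set V} (hX : Bornology.IsBounded X) :
    ∃ A, HasGeometricCovering X A := by
  obtain ⟨T, -, hTfin, hT⟩ := exists_finite_isCover_of_isCompact (ε := 1 / 2) (by norm_num)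
    (isCompact_closedBall (0 : V) 1)
  lift T to Finset V using hTfin
  obtain ⟨m, hm⟩ : ∃ m : ℕ, X ⊆ closedBall 0 ((2 ^ m : ℝ≥0) : ℝ) := by
    obtain ⟨r, hr⟩ := hX.subset_closedBall 0
    obtain ⟨m, hm⟩ := pow_unbounded_of_one_lt r one_lt_two
    exact ⟨m, hr.trans (closedBall_subset_closedBall (by exact_mod_cast hm.le))⟩
  have hT0 : T.Nonempty := hT.nonempty ⟨0, by simp⟩
  refine ⟨T.card ^ (m + 1), fun k => ?_⟩
  obtain ⟨N, hcard, hN⟩ := exists_isCover_closedBall_card_le hT (R := 2 ^ m) (by simp) (k + m + 1)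
  have hscale : (2 : ℝ≥0) * (2 ^ m * (1 / 2) ^ (k + m + 1)) = (1 / 2) ^ k := by
    rw [one_div, inv_pow, inv_pow, pow_succ, pow_add]
    field_simp
  have hexp : k + m + 1 ≤ (m + 1) * (k + 1) := by nlinarith
  calc coveringNumber ((1 / 2) ^ k) (Set.univ : Set X)
      = coveringNumber ((1 / 2) ^ k) X := by
        rw [← isometry_subtype_coe.coveringNumber_image, Set.image_univ,
          Subtype.range_coe]
    _ ≤ externalCoveringNumber (2 ^ m * (1 / 2) ^ (k + m + 1)) X :=
        hscale ▸ coveringNumber_two_mul_le_externalCoveringNumber _ _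
    _ ≤ N.card := by
        simpa using (hN.anti hm).externalCoveringNumber_le_encard
    _ ≤ ((T.card ^ (m + 1)) ^ (k + 1) : ℕ) := by
        rw [← pow_mul]
        exact_mod_cast hcard.trans (Nat.pow_le_pow_right hT0.card_pos hexp)

end Covering

section FreshSamples

variable {Ω Γ ι E : Type*} [MeasurableSpace Ω] {P : Measure Ω} [IsProbabilityMeasure P]
  [MeasurableSpace Γ] [MeasurableSpace E] {μ : Measure E} {ℓ : ℝ≥0}

lemma hasSubgaussianMGF_sum_sub_integral {T : Finset ι} {Y : ι → Ω → E}
    (hY : ∀ i, Measurable (Y i)) (hind : iIndepFun Y P) (hμ : ∀ i ∈ T, P.map (Y i) = μ)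
    {φ : E → ℝ} (hφ : Measurable φ) (hℓ : ∀ y, |φ y| ≤ ℓ) :
    HasSubgaussianMGF (fun ω => ∑ i ∈ T, (φ (Y i ω) - ∫ y, φ y ∂μ)) (T.card * ℓ ^ 2) P := by
  rw [← nsmul_eq_mul, ← Finset.sum_const]
  refine HasSubgaussianMGF.sum_of_iIndepFun
    (hind.comp (fun _ y => φ y - ∫ y, φ y ∂μ) fun _ => hφ.sub_const _) fun i hi => ?_
  have hmean : ∫ y, φ y ∂μ = ∫ ω, φ (Y i ω) ∂P := by
    rw [← hμ i hi, integral_map (hY i).aemeasurable hφ.aestronglyMeasurable]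
  have hhoeffding := hasSubgaussianMGF_of_mem_Icc (μ := P) (X := fun ω => φ (Y i ω))
    (a := -ℓ) (b := ℓ) (hφ.comp (hY i)).aemeasurable (ae_of_all _ fun ω => abs_le.1 (hℓ _))
  have hwidth : ‖(ℓ : ℝ) - -ℓ‖₊ / 2 = ℓ := by
    ext
    push_cast
    rw [sub_neg_eq_add, ← two_mul, norm_mul]
    simp
  rw [hwidth, ← hmean] at hhoeffding
  exact hhoeffding

lemma hasSubgaussianMGF_of_indepFun {G : Ω → Γ} {Z : Ω → E} (hG : Measurable G)
    (hZ : Measurable Z) (hGZ : IndepFun G Z P) {ψ : Γ → E → ℝ}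
    (hψ : Measurable (Function.uncurry ψ)) {v : ℝ≥0}
    (h : ∀ γ, HasSubgaussianMGF (fun ω => ψ γ (Z ω)) v P) :
    HasSubgaussianMGF (fun ω => ψ (G ω) (Z ω)) v P := by
  have := Measure.isProbabilityMeasure_map (μ := P) hG.aemeasurable
  have := Measure.isProbabilityMeasure_map (μ := P) hZ.aemeasurable
  have hlaw := hGZ.map_prod_eq_prod_map_map hG.aemeasurable hZ.aemeasurable
  have hfib : ∀ γ, HasSubgaussianMGF (ψ γ) v (P.map Z) := fun γ => by
    refine (h γ).congr_identDistrib
      ⟨(h γ).aemeasurable, (hψ.comp measurable_prodMk_left).aemeasurable, ?_⟩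
    exact (Measure.map_map (hψ.comp measurable_prodMk_left) hZ).symm
  have hexp : ∀ t : ℝ, Measurable fun z : Γ × E => Real.exp (t * ψ z.1 z.2) := fun t =>
    (hψ.const_mul t).exp
  have hint : ∀ t : ℝ, Integrable (fun z : Γ × E => Real.exp (t * ψ z.1 z.2))
      ((P.map G).prod (P.map Z)) := fun t => by
    refine (integrable_prod_iff (hexp t).aestronglyMeasurable).2
      ⟨ae_of_all _ fun γ => (hfib γ).integrable_exp_mul t, ?_⟩
    refine Integrable.of_mem_Icc 0 (Real.exp (v * t ^ 2 / 2))
      (hexp t).norm.stronglyMeasurable.integral_prod_right'.measurable.aemeasurable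
      (ae_of_all _ fun γ => ⟨by positivity, ?_⟩)
    simp only [Real.norm_of_nonneg (Real.exp_pos _).le]
    exact (hfib γ).mgf_le t
  have hpair : HasSubgaussianMGF (fun z : Γ × E => ψ z.1 z.2) v ((P.map G).prod (P.map Z)) := by
    refine ⟨hint, fun t => ?_⟩
    rw [mgf, integral_prod _ (hint t)]
    calc _ ≤ ∫ _γ, Real.exp (v * t ^ 2 / 2) ∂P.map G :=
          integral_mono (hint t).integral_prod_left (integrable_const _)
            fun γ => (hfib γ).mgf_le t
      _ = _ := by rw [integral_const, probReal_univ, one_smul]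
  rw [← hlaw] at hpair
  exact hpair.of_map (hG.prodMk hZ).aemeasurable

lemma hasSubgaussianMGF_sum_of_dependsOn [SFinite μ] {Z : ι → Ω → E} (hZ : ∀ i, Measurable (Z i))
    (hind : iIndepFun Z P) {S T : Finset ι} (hST : Disjoint S T) (hμ : ∀ i ∈ T, P.map (Z i) = μ)
    {φ : (ι → E) → E → ℝ} (hφ : Measurable (Function.uncurry φ)) (hφS : DependsOn φ (S : Set ι))
    (hℓ : ∀ γ y, |φ γ y| ≤ ℓ) :
    HasSubgaussianMGF
      (fun ω => ∑ i ∈ T, (φ (Z · ω) (Z i ω) - ∫ y, φ (Z · ω) y ∂μ)) (T.card * ℓ ^ 2) P := by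
  classical
  obtain ⟨ω₀⟩ := nonempty_of_isProbabilityMeasure P
  let past : (S → E) → ι → E := Function.updateFinset (Z · ω₀) S
  have hpast : Measurable past := measurable_updateFinset
  have hφpast : ∀ ω, φ (Z · ω) = φ (past fun i => Z i ω) := fun ω => hφS fun i hi => by
    simp [past, Function.updateFinset, Finset.mem_coe.1 hi]
  let ψ : (S → E) → (T → E) → ℝ := fun γ z => ∑ i, (φ (past γ) (z i) - ∫ y, φ (past γ) y ∂μ)
  have hψ : Measurable (Function.uncurry ψ) := by
    refine Finset.measurable_sum _ fun i _ => Measurable.sub ?_ ?_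
    · exact hφ.comp ((hpast.comp measurable_fst).prodMk
        ((measurable_pi_apply i).comp measurable_snd))
    · exact hφ.stronglyMeasurable.integral_prod_right.measurable.comp (hpast.comp measurable_fst)
  have hψZ : ∀ γ ω, ψ γ (fun i => Z i ω)
      = ∑ i ∈ T, (φ (past γ) (Z i ω) - ∫ y, φ (past γ) y ∂μ) := fun γ ω =>
    Finset.sum_coe_sort T fun i => φ (past γ) (Z i ω) - ∫ y, φ (past γ) y ∂μ
  simp only [hφpast, ← hψZ]
  refine hasSubgaussianMGF_of_indepFun (G := fun ω (i : S) => Z i ω) (Z := fun ω (i : T) => Z i ω)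
    (by fun_prop) (by fun_prop) (hind.indepFun_finset S T hST hZ) hψ fun γ => ?_
  simp only [hψZ]
  exact hasSubgaussianMGF_sum_sub_integral hZ hind hμ (hφ.comp measurable_prodMk_left) (hℓ _)

/-- The error of the empirical mean of `φ` over the sample points `z i`, `i ∈ T`, as an estimate of
`∫ φ dμ`. -/
def meanDeviation (μ : Measure E) (T : Finset ι) (z : ι → E) (φ : E → ℝ) : ℝ :=
  (∑ i ∈ T, φ (z i)) / T.card - ∫ y, φ y ∂μ

lemma meanDeviation_sub {T : Finset ι} {z : ι → E} {φ ψ : E → ℝ} (hφ : Integrable φ μ)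
    (hψ : Integrable ψ μ) :
    meanDeviation μ T z φ - meanDeviation μ T z ψ = meanDeviation μ T z (φ - ψ) := by
  simp only [meanDeviation, Pi.sub_apply, Finset.sum_sub_distrib, integral_sub hφ hψ]
  ring

lemma abs_meanDeviation_le [IsProbabilityMeasure μ] {T : Finset ι} {z : ι → E} {φ : E → ℝ}
    {c : ℝ} (hT : T.Nonempty) (hc : ∀ y, |φ y| ≤ c) : |meanDeviation μ T z φ| ≤ 2 * c := by
  have hcard : 0 < (T.card : ℝ) := by exact_mod_cast hT.card_pos
  have hint : |∫ y, φ y ∂μ| ≤ c := by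
    simpa using norm_integral_le_of_norm_le_const (f := φ) (C := c) (μ := μ)
      (ae_of_all _ fun y => hc y)
  have hmean : |(∑ i ∈ T, φ (z i)) / T.card| ≤ c := by
    rw [abs_div, abs_of_pos hcard, div_le_iff₀' hcard, ← nsmul_eq_mul]
    exact (Finset.abs_sum_le_sum_abs _ _).trans (Finset.sum_le_card_nsmul _ _ _ fun i _ => hc _)
  exact (abs_sub _ _).trans (by linarith)

section

variable [IsProbabilityMeasure μ] {Z : ι → Ω → E} (hZ : ∀ i, Measurable (Z i))
  (hind : iIndepFun Z P) {S T : Finset ι} (hST : Disjoint S T) (hT : T.Nonempty)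
  (hμ : ∀ i ∈ T, P.map (Z i) = μ)
include hZ hind hST hT hμ

lemma hasSubgaussianMGF_meanDeviation {φ : (ι → E) → E → ℝ} (hφ : Measurable (Function.uncurry φ))
    (hφS : DependsOn φ (S : Set ι)) (hℓ : ∀ γ y, |φ γ y| ≤ ℓ) :
    HasSubgaussianMGF (fun ω => meanDeviation μ T (Z · ω) (φ (Z · ω)))
      ((ℓ / NNReal.sqrt T.card) ^ 2) P := by
  have : 0 < (T.card : ℝ≥0) := by exact_mod_cast hT.card_pos
  have hparam : T.card * (ℓ / T.card) ^ 2 = (ℓ / NNReal.sqrt T.card) ^ 2 := by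
    rw [div_pow _ (NNReal.sqrt _), NNReal.sq_sqrt]
    field_simp
  have hsum := hasSubgaussianMGF_sum_of_dependsOn (ℓ := ℓ / T.card) (φ := fun γ y => φ γ y / T.card)
    hZ hind hST hμ (hφ.div_const _) (fun γ γ' h => by simp only [hφS h]) fun γ y => by
      rw [abs_div, Nat.abs_cast, NNReal.coe_div, NNReal.coe_natCast]
      gcongr
      exact hℓ γ y
  rw [hparam] at hsum
  refine hsum.congr (ae_of_all _ fun ω => ?_)
  have hcard' : (T.card : ℝ) ≠ 0 := by exact_mod_cast hT.card_ne_zero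
  simp only [meanDeviation, integral_div, Finset.sum_sub_distrib, Finset.sum_const, nsmul_eq_mul,
    ← Finset.sum_div]
  field_simp

lemma HasGeometricCovering.expectedSupLE_meanDeviation {X : Type*} [PseudoMetricSpace X]
    [Nonempty X] {A : ℕ} (hA : HasGeometricCovering X A) {F : X → (ι → E) → E → ℝ}
    (hF : ∀ x, Measurable (Function.uncurry (F x))) (hFS : ∀ x, DependsOn (F x) (S : Set ι))
    (hℓ : 0 < ℓ) (hFℓ : ∀ x γ y, |F x γ y| ≤ ℓ) (hLip : ∀ γ y, LipschitzWith ℓ (F · γ y)) :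
    ExpectedSupLE P Set.univ (fun x ω => meanDeviation μ T (Z · ω) (F x (Z · ω)))
      (ℓ / √T.card * (7 * Real.log (4 * A) + 1)) := by
  have : 0 < (T.card : ℝ≥0) := by exact_mod_cast hT.card_pos
  have hint : ∀ x γ, Integrable (F x γ) μ := fun x γ =>
    Integrable.of_mem_Icc (-ℓ) ℓ ((hF x).comp measurable_prodMk_left).aemeasurable
      (ae_of_all _ fun y => abs_le.1 (hFℓ x γ y))
  have hsub : ∀ x x' ω, meanDeviation μ T (Z · ω) (F x (Z · ω))
      - meanDeviation μ T (Z · ω) (F x' (Z · ω))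
      = meanDeviation μ T (Z · ω) (F x (Z · ω) - F x' (Z · ω)) := fun x x' ω =>
    meanDeviation_sub (hint _ _) (hint _ _)
  have hdist : ∀ x x' γ y, |F x γ y - F x' γ y| ≤ ℓ * dist x x' := fun x x' γ y =>
    (hLip γ y).dist_le_mul x x'
  have hmain := hA.expectedSupLE (P := P) (K := 2 * ℓ) (v := ℓ / NNReal.sqrt T.card)
    (W := fun x ω => meanDeviation μ T (Z · ω) (F x (Z · ω))) (by positivity)
    (fun x => hasSubgaussianMGF_meanDeviation hZ hind hST hT hμ (hF x) (hFS x) (hFℓ x)) ?_ ?_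
  · simpa using hmain
  · intro x x' r hr
    simp only [hsub]
    rw [div_mul_eq_mul_div]
    refine hasSubgaussianMGF_meanDeviation (φ := fun γ => F x γ - F x' γ) hZ hind hST hT hμ
      ((hF x).sub (hF x')) (fun γ γ' h => ?_) fun γ y => (hdist x x' γ y).trans ?_
    · simp only [hFS x h, hFS x' h]
    · rw [NNReal.coe_mul]
      gcongr
      exact_mod_cast hr
  · refine fun ω => LipschitzWith.of_dist_le_mul fun x x' => ?_
    rw [Real.dist_eq, hsub, NNReal.coe_mul, NNReal.coe_ofNat, mul_assoc]
    exact abs_meanDeviation_le hT (hdist x x' _)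

end

end FreshSamples

section Step

variable {E : Type*} [MeasurableSpace E] {k : E → E → ℝ} {a b : E → ℝ} {η : ℕ → ℝ} {n₀ : ℕ}
  {B : ℕ → ℕ} {γ : ℕ ⊕ ℕ → E} {ρ θ σ σ' : ℝ} {α β : Measure E} [IsProbabilityMeasure α]
  [IsProbabilityMeasure β]

lemma ratioLE_scalings_succ (hs : IsSchedule η n₀ B) (hkβ : IsMarkovDensity k β ρ)
    (hkα : IsMarkovDensity (fun y x => k x y) α ρ) (ha : ∀ y, 0 < a y) (hb : ∀ x, 0 < b x) (t : ℕ)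
    (hum : Measurable (scalings k a b η n₀ B γ (t + 1)).1)
    (hvm : Measurable (scalings k a b η n₀ B γ t).2) (z₀ : E)
    (hσ : ∀ x, |(scalings k a b η n₀ B γ t).2 z₀ *
      (batchMean (fun y => k x y / (scalings k a b η n₀ B γ t).2 y) (γ ∘ .inr)
        (sampleCount n₀ B t) (B (t + 1)) -
      ∫ y, k x y / (scalings k a b η n₀ B γ t).2 y ∂β)| ≤ σ)
    (hσ' : ∀ y, |(scalings k a b η n₀ B γ (t + 1)).1 z₀ *
      (batchMean (fun x => k x y / (scalings k a b η n₀ B γ (t + 1)).1 x) (γ ∘ .inl)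
        (sampleCount n₀ B t) (B (t + 1)) -
      ∫ x, k x y / (scalings k a b η n₀ B γ (t + 1)).1 x ∂α)| ≤ σ')
    (hu : RatioLE (scalings k a b η n₀ B γ t).1 (1 + θ))
    (hv : RatioLE (scalings k a b η n₀ B γ t).2 (1 + θ)) :
    RatioLE (scalings k a b η n₀ B γ (t + 1)).1
      (1 + ((1 - ρ⁻¹ / ρ ^ 6 * η (t + 1)) * θ + η (t + 1) * (2 * ρ ^ 17 * (σ + σ')))) ∧
    RatioLE (scalings k a b η n₀ B γ (t + 1)).2
      (1 + ((1 - ρ⁻¹ / ρ ^ 6 * η (t + 1)) * θ + η (t + 1) * (2 * ρ ^ 17 * (σ + σ')))) := by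
  have hρ := hkβ.pos
  have hne : Nonempty E := ⟨z₀⟩
  have hη := hs.step_mem t
  have hθ : 0 ≤ θ := by linarith [hu.one_le]
  have hσ₀ : 0 ≤ σ := (abs_nonneg _).trans (hσ z₀)
  have hσ₀' : 0 ≤ σ' := (abs_nonneg _).trans (hσ' z₀)
  have hratio := ratioLE_scalings (γ := γ) hs hkβ.one_le hkβ.mem_Icc ha hb
  have hprod := scalings_mul_mem_Icc (γ := γ) hs hkβ.one_le hkβ.mem_Icc ha hb t
  have hfst := hkβ.ratioLE_relaxedUpdate (hs.one_le_batch t) hη (hratio t).2 hvm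
    (fun x => hprod.1 x z₀) hσ le_rfl hu (by simpa only [add_zero] using hv)
  have hfst_le : RatioLE (scalings k a b η n₀ B γ (t + 1)).1 (1 + (θ + 2 * ρ ^ 11 * σ)) := by
    refine hfst.mono ?_
    have hdecay : 0 ≤ ρ⁻¹ / ρ ^ 6 * η (t + 1) * θ := by have := hη.1; positivity
    have hnoise := mul_le_of_le_one_left (by positivity : 0 ≤ 2 * ρ ^ 11 * σ) hη.2
    linear_combination hdecay + hnoise
  have hsnd := hkα.ratioLE_relaxedUpdate (hs.one_le_batch t) hη (hratio (t + 1)).1 hum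
    (fun y => hprod.2 y z₀) hσ' (by positivity) hv hfst_le
  have hpow : ρ ^ 11 ≤ ρ ^ 17 := pow_le_pow_right₀ hkβ.one_le (by norm_num)
  refine ⟨hfst.mono ?_, hsnd.mono ?_⟩ <;> gcongr 1 + (_ + η (t + 1) * ?_)
  · exact hη.1
  · linear_combination 2 * σ * hpow + 2 * σ' * (pow_pos hρ 17).le
  · exact hη.1
  · linear_combination 2 * σ' * hpow

end Step

section Recursion

variable {Ω E : Type*} [MeasurableSpace Ω] {P : Measure Ω} [IsProbabilityMeasure P]
  [PseudoMetricSpace E] [SecondCountableTopology E] [MeasurableSpace E] [BorelSpace E]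
  {Z : ℕ ⊕ ℕ → Ω → E} {A : ℕ} {k : E → E → ℝ} {ρ : ℝ} {K ℓ : ℝ≥0}

lemma expectedSupLE_batchMean_sub_integral (hA : HasGeometricCovering E A)
    (hZ : ∀ i, Measurable (Z i)) (hind : iIndepFun Z P) {μ : Measure E} [IsProbabilityMeasure μ]
    (e : ℕ ↪ ℕ ⊕ ℕ) (hμ : ∀ i, P.map (Z (e i)) = μ) {S : Finset (ℕ ⊕ ℕ)} {n m : ℕ}
    (hS : ∀ i, n ≤ i → e i ∉ S) (hm : 1 ≤ m) (hρ : 0 < ρ) (hk : ∀ x y, k x y ∈ Set.Icc ρ⁻¹ ρ)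
    (hkc : Continuous (Function.uncurry k)) (hkL : ∀ y, LipschitzWith K (k · y))
    (hρℓ : ρ ^ 3 ≤ ℓ) (hKℓ : ρ ^ 2 * K ≤ ℓ) {v : (ℕ ⊕ ℕ → E) → E → ℝ}
    (hvc : Continuous (Function.uncurry v)) (hv : ∀ γ, RatioLE (v γ) (ρ ^ 2))
    (hvS : DependsOn v (S : Set (ℕ ⊕ ℕ))) (z₀ : E) :
    ExpectedSupLE P Set.univ (fun x ω => v (Z · ω) z₀ *
        (batchMean (fun y => k x y / v (Z · ω) y) ((Z · ω) ∘ e) n m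
          - ∫ y, k x y / v (Z · ω) y ∂μ))
      (ℓ / √m * (7 * Real.log (4 * A) + 1)) := by
  have hne : Nonempty E := ⟨z₀⟩
  set T := (Finset.Ico n (n + m)).map e with hT
  have hcard : T.card = m := by simp [T]
  have hST : Disjoint S T := Finset.disjoint_right.2 fun j hj => by
    obtain ⟨i, hi, rfl⟩ := Finset.mem_map.1 hj
    exact hS i (Finset.mem_Ico.1 hi).1
  have hmain := hA.expectedSupLE_meanDeviation hZ hind hST
    (Finset.card_pos.1 (hcard ▸ hm)) (μ := μ) (ℓ := ℓ) (fun j hj => ?_)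
    (F := fun x γ y => v γ z₀ * (k x y / v γ y)) (fun x => ?_) (fun x γ γ' h => ?_)
    (NNReal.coe_pos.1 ((pow_pos hρ 3).trans_le hρℓ)) (fun x γ y => ?_) fun γ y => ?_
  · rw [hcard] at hmain
    convert! hmain using 3 with x ω
    rw [mul_sub, mul_batchMean, ← integral_const_mul, meanDeviation, hcard, hT, Finset.sum_map]
    rfl
  · obtain ⟨i, -, rfl⟩ := Finset.mem_map.1 hj
    exact hμ i
  · exact ((hvc.comp (continuous_fst.prodMk continuous_const)).mul
      ((hkc.comp (continuous_const.prodMk continuous_snd)).div hvc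
        fun p => ((hv _).pos _).ne')).measurable
  · simp only [hvS h]
  · have hmem := (hv γ).mul_div_mem_Icc hρ (hk x y) (z := z₀) (z' := y)
    rw [abs_of_nonneg ((inv_nonneg.2 (pow_pos hρ 3).le).trans hmem.1)]
    exact hmem.2.trans hρℓ
  · refine LipschitzWith.of_dist_le_mul fun x x' => ?_
    have hquot : v γ z₀ / v γ y ≤ ρ ^ 2 := (div_le_iff₀ ((hv γ).pos y)).2 ((hv γ).le _ _)
    have hquot₀ : 0 ≤ v γ z₀ / v γ y := (div_pos ((hv γ).pos _) ((hv γ).pos _)).le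
    calc dist (v γ z₀ * (k x y / v γ y)) (v γ z₀ * (k x' y / v γ y))
        = v γ z₀ / v γ y * dist (k x y) (k x' y) := by
          have hcomm (s : ℝ) : v γ z₀ * (s / v γ y) = v γ z₀ / v γ y * s := by ring
          rw [Real.dist_eq, Real.dist_eq, hcomm, hcomm, ← mul_sub, abs_mul, abs_of_nonneg hquot₀]
      _ ≤ ρ ^ 2 * (K * dist x x') := by
          gcongr
          exact (hkL y).dist_le_mul x x'
      _ ≤ ℓ * dist x x' := by
          rw [← mul_assoc]
          gcongr

/-- The random functions `W ω` have, in expectation, relative oscillation at most `r`. -/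
def ExpectedRatioLE (P : Measure Ω) (W : Ω → (E → ℝ) × (E → ℝ)) (r : ℝ) : Prop :=
  ∃ θ : Ω → ℝ, Integrable θ P ∧
    (∀ ω, RatioLE (W ω).1 (1 + θ ω) ∧ RatioLE (W ω).2 (1 + θ ω)) ∧ ∫ ω, θ ω ∂P ≤ r

variable {a b : E → ℝ} {η : ℕ → ℝ} {n₀ : ℕ} {B : ℕ → ℕ} {α β : Measure E}
  [IsProbabilityMeasure α] [IsProbabilityMeasure β] [Nonempty E]
  (hA : HasGeometricCovering E A) (hZ : ∀ i, Measurable (Z i)) (hind : iIndepFun Z P)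
  (hα : ∀ i, P.map (Z (.inl i)) = α) (hβ : ∀ i, P.map (Z (.inr i)) = β)
  (hs : IsSchedule η n₀ B) (hkβ : IsMarkovDensity k β ρ)
  (hkα : IsMarkovDensity (fun y x => k x y) α ρ) (hkc : Continuous (Function.uncurry k))
  (hkL : ∀ y, LipschitzWith K (k · y)) (hkL' : ∀ x, LipschitzWith K (k x))
  (hρℓ : ρ ^ 3 ≤ ℓ) (hKℓ : ρ ^ 2 * K ≤ ℓ) (ha : ∀ y, 0 < a y) (hb : ∀ x, 0 < b x)
  (hac : Continuous a) (hbc : Continuous b)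
include hA hZ hind hα hβ hs hkβ hkα hkc hkL hkL' hρℓ hKℓ ha hb hac hbc

lemma ExpectedRatioLE.scalings_succ {t : ℕ} {r : ℝ}
    (hr : ExpectedRatioLE P (fun ω => scalings k a b η n₀ B (Z · ω) t) r) :
    ExpectedRatioLE P (fun ω => scalings k a b η n₀ B (Z · ω) (t + 1))
      ((1 - ρ⁻¹ / ρ ^ 6 * η (t + 1)) * r + η (t + 1) *
        (4 * ρ ^ 17 * (ℓ / √(B (t + 1)) * (7 * Real.log (4 * A) + 1)))) := by
  obtain ⟨θ, hθ, hratio, hθr⟩ := hr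
  obtain ⟨z₀⟩ := ‹Nonempty E›
  have hbound := fun γ : ℕ ⊕ ℕ → E => ratioLE_scalings (γ := γ) hs hkβ.one_le hkβ.mem_Icc ha hb
  have hcont := continuous_scalings hs hkβ.one_le hkβ.mem_Icc ha hb hkc hac hbc
  obtain ⟨σ, hσ, hσ_dev, hσ_le⟩ := expectedSupLE_batchMean_sub_integral hA hZ hind
    .inr hβ (v := fun γ => (scalings k a b η n₀ B γ t).2) (n := sampleCount n₀ B t)
    (fun i hi => by simpa using hi)
    (hs.one_le_batch t) hkβ.pos hkβ.mem_Icc hkc hkL hρℓ hKℓ (hcont t).2 (fun γ => (hbound γ t).2)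
    (fun γ γ' h => congrArg Prod.snd (dependsOn_scalings t h)) z₀
  obtain ⟨σ', hσ', hσ_dev', hσ_le'⟩ := expectedSupLE_batchMean_sub_integral hA hZ hind
    .inl hα (v := fun γ => (scalings k a b η n₀ B γ (t + 1)).1) (n := sampleCount n₀ B t)
    (fun i hi => by simpa using hi)
    (hs.one_le_batch t) hkα.pos hkα.mem_Icc (hkc.comp continuous_swap) hkL' hρℓ hKℓ
    (hcont (t + 1)).1 (fun γ => (hbound γ (t + 1)).1) (dependsOn_scalings_fst_succ t) z₀
  refine ⟨_, (hθ.const_mul _).add (((hσ.add hσ').const_mul _).const_mul _), fun ω =>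
    ratioLE_scalings_succ hs hkβ hkα ha hb t
      ((hcont (t + 1)).1.comp (Continuous.prodMk_right _)).measurable
      ((hcont t).2.comp (Continuous.prodMk_right _)).measurable z₀
      (fun x => hσ_dev x trivial ω) (fun y => hσ_dev' y trivial ω) (hratio ω).1 (hratio ω).2, ?_⟩
  have hη := hs.step_mem t
  have hρ := hkβ.pos
  have hcontract : ρ⁻¹ / ρ ^ 6 * η (t + 1) ≤ 1 := by
    refine mul_le_one₀ ((div_le_one (by positivity)).2 ?_) hη.1 hη.2
    exact (inv_le_one_of_one_le₀ hkβ.one_le).trans (one_le_pow₀ hkβ.one_le)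
  rw [integral_add' (hθ.const_mul _) (((hσ.add hσ').const_mul _).const_mul _),
    integral_const_mul, integral_const_mul, integral_const_mul, integral_add' hσ hσ']
  refine add_le_add (mul_le_mul_of_nonneg_left hθr (by linarith))
    (mul_le_mul_of_nonneg_left ?_ hη.1)
  linear_combination 2 * ρ ^ 17 * (hσ_le + hσ_le')

lemma expectedRatioLE_scalings {r : ℕ → ℝ} (hr₀ : ρ ^ 2 ≤ 1 + r 0)
    (hr : ∀ t, (1 - ρ⁻¹ / ρ ^ 6 * η (t + 1)) * r t + η (t + 1) *
      (4 * ρ ^ 17 * (ℓ / √(B (t + 1)) * (7 * Real.log (4 * A) + 1))) ≤ r (t + 1)) (t : ℕ) :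
    ExpectedRatioLE P (fun ω => scalings k a b η n₀ B (Z · ω) t) (r t) := by
  induction t with
  | zero =>
    have hinit := fun ω => ratioLE_scalings (γ := (Z · ω)) hs hkβ.one_le hkβ.mem_Icc ha hb 0
    exact ⟨fun _ => r 0, integrable_const _,
      fun ω => ⟨(hinit ω).1.mono hr₀, (hinit ω).2.mono hr₀⟩, by simp⟩
  | succ t ih =>
    obtain ⟨θ, hθ, hratio, hθr⟩ := ih.scalings_succ hA hZ hind hα hβ hs hkβ hkα hkc hkL hkL' hρℓ
      hKℓ ha hb hac hbc
    exact ⟨θ, hθ, hratio, hθr.trans (hr t)⟩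

end Recursion

section Supersolution

variable {a b c s D K T : ℝ}

lemma one_sub_div_mul_rpow_neg_le {q : ℝ} (hq : 1 < q) :
    (1 - max a 1 / q) * (q - 1) ^ (-a) ≤ q ^ (-a) := by
  have hq0 : 0 < q := one_pos.trans hq
  have hq1 : 0 < q - 1 := sub_pos.2 hq
  have bernoulli : 1 - max a 1 / q ≤ ((q - 1) / q) ^ max a 1 := by
    have h := one_add_mul_self_le_rpow_one_add (s := -q⁻¹) (p := max a 1)
      (neg_le_neg (inv_le_one_of_one_le₀ hq.le)) (le_max_right _ _)
    rwa [mul_neg, ← div_eq_mul_inv, ← sub_eq_add_neg, ← sub_eq_add_neg,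
      show 1 - q⁻¹ = (q - 1) / q by field_simp] at h
  calc (1 - max a 1 / q) * (q - 1) ^ (-a) ≤ ((q - 1) / q) ^ a * (q - 1) ^ (-a) := by
        gcongr
        exact bernoulli.trans (Real.rpow_le_rpow_of_exponent_ge (by positivity)
          ((div_le_one hq0).2 (by linarith)) (le_max_left _ _))
    _ = q ^ (-a) := by
        rw [Real.div_rpow hq1.le hq0.le, Real.rpow_neg hq1.le, Real.rpow_neg hq0.le]
        field_simp

lemma one_sub_mul_rpow_mul_rpow_neg_le (hb : -1 ≤ b) (hb0 : b ≤ 0) (hc : 0 < c)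
    (hc1 : c ≤ 1) (hs : 0 < s) (hsc : 2 * max a 1 / c ≤ s ^ (1 + b)) (hT : 1 ≤ T) :
    (1 - c * T ^ b) * (T + s - 1) ^ (-a) ≤ (1 - c * T ^ b / 2) * (T + s) ^ (-a) := by
  have hT0 : 0 < T := by linarith
  have hq : 0 < T + s := by linarith
  have hTb : c * T ^ b ≤ 1 :=
    mul_le_one₀ hc1 (by positivity) (Real.rpow_le_one_of_one_le_of_nonpos hT hb0)
  have hgain : max a 1 / (T + s) ≤ c * T ^ b / 2 := by
    have h : 2 * max a 1 / c ≤ (T + s) * T ^ b :=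
      calc 2 * max a 1 / c ≤ (T + s) ^ (1 + b) :=
            hsc.trans (Real.rpow_le_rpow hs.le (by linarith) (by linarith))
        _ = (T + s) * (T + s) ^ b := by rw [Real.rpow_add hq, Real.rpow_one]
        _ ≤ (T + s) * T ^ b := by
            gcongr 1
            exact Real.rpow_le_rpow_of_nonpos hT0 (by linarith) hb0
    rw [div_le_iff₀ hc] at h
    rw [div_le_iff₀ hq]
    linarith
  have hgain₀ : 0 ≤ max a 1 / (T + s) := by positivity
  have hpos : 0 ≤ (T + s - 1) ^ (-a) := Real.rpow_nonneg (by linarith) _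
  calc (1 - c * T ^ b) * (T + s - 1) ^ (-a)
      ≤ (1 - c * T ^ b / 2) * (1 - max a 1 / (T + s)) * (T + s - 1) ^ (-a) := by
        gcongr
        nlinarith
    _ ≤ (1 - c * T ^ b / 2) * (T + s) ^ (-a) := by
        rw [mul_assoc]
        exact mul_le_mul_of_nonneg_left (one_sub_div_mul_rpow_neg_le (by linarith))
          (by linarith)

lemma mul_rpow_sub_le_mul_rpow_neg (ha : 0 ≤ a) (hc : 0 < c) (hs : 0 ≤ s) (hD : 0 ≤ D)
    (hK : 2 * D * (1 + s) ^ a / c ≤ K) (hT : 1 ≤ T) :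
    D * T ^ (b - a) ≤ K * (c * T ^ b / 2 * (T + s) ^ (-a)) := by
  have hT0 : 0 < T := by linarith
  have hq : 0 < T + s := by linarith
  have hscale : (T + s) ^ a ≤ (1 + s) ^ a * T ^ a := by
    rw [← Real.mul_rpow (by linarith) hT0.le]
    exact Real.rpow_le_rpow hq.le (by nlinarith) ha
  calc D * T ^ (b - a) = D * T ^ b * (T + s) ^ a / (T ^ a * (T + s) ^ a) := by
        rw [Real.rpow_sub hT0]
        field_simp
    _ ≤ D * T ^ b * ((1 + s) ^ a * T ^ a) / (T ^ a * (T + s) ^ a) := by gcongr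
    _ = 2 * D * (1 + s) ^ a / c * (c * T ^ b / 2 * (T + s) ^ (-a)) := by
        rw [Real.rpow_neg hq.le]
        field_simp
    _ ≤ K * (c * T ^ b / 2 * (T + s) ^ (-a)) := by gcongr

-- The shifted power `K (t + s) ^ (-a)` works: its relative decrease `a / (t + s)` in one step is at
-- most half of the contraction `c t ^ b`, as `b > -1`, and the other half absorbs the noise.
lemma exists_supersolution {R : ℝ} (ha : 0 ≤ a) (hb : -1 < b) (hb0 : b ≤ 0) (hc : 0 < c)
    (hc1 : c ≤ 1) (hD : 0 ≤ D) (hR : 0 < R) :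
    ∃ K > 0, ∃ r : ℕ → ℝ, R ≤ r 0 ∧
      (∀ t : ℕ, (1 - c * ((t + 1 : ℕ) : ℝ) ^ b) * r t + D * ((t + 1 : ℕ) : ℝ) ^ (b - a)
        ≤ r (t + 1)) ∧
      ∀ t : ℕ, 1 ≤ t → r t ≤ K * (t : ℝ) ^ (-a) := by
  obtain ⟨s, hsc, hs⟩ : ∃ s : ℝ, 2 * max a 1 / c ≤ s ^ (1 + b) ∧ 0 < s :=
    (((tendsto_rpow_atTop (by linarith : 0 < 1 + b)).eventually_ge_atTop _).and
      (eventually_gt_atTop 0)).exists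
  have hsa : 0 < s ^ a := by positivity
  set K : ℝ := max (R * s ^ a) (2 * D * (1 + s) ^ a / c)
  have hK : 0 < K := lt_max_of_lt_left (mul_pos hR hsa)
  refine ⟨K, hK, fun t => K * (t + s) ^ (-a), ?_, fun t => ?_, fun t ht => ?_⟩
  · simp only [Nat.cast_zero, zero_add]
    rw [Real.rpow_neg hs.le, ← div_eq_mul_inv, le_div_iff₀ hsa]
    exact le_max_left _ _
  · have ht : (1 : ℝ) ≤ (t + 1 : ℕ) := by exact_mod_cast Nat.le_add_left 1 t
    have hdrift := mul_le_mul_of_nonneg_left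
      (one_sub_mul_rpow_mul_rpow_neg_le hb.le hb0 hc hc1 hs hsc ht) hK.le
    have hnoise := mul_rpow_sub_le_mul_rpow_neg (b := b) ha hc hs.le hD
      (le_max_right (R * s ^ a) _) ht
    have hshift : ((t + 1 : ℕ) : ℝ) + s - 1 = t + s := by push_cast; ring
    rw [hshift] at hdrift
    linear_combination hdrift + hnoise
  · have ht₀ : (0 : ℝ) < t := by exact_mod_cast ht
    exact mul_le_mul_of_nonneg_left
      (Real.rpow_le_rpow_of_nonpos ht₀ (by linarith) (by linarith)) hK.le

end Supersolution

section PowerSchedule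

variable {a : ℝ} {B : ℕ → ℕ} (ha : 0 < a)

include ha

lemma one_le_of_abs_sub_lt {t : ℕ} (ht : 1 ≤ t) (hB : |(B t : ℝ) - (t : ℝ) ^ (2 * a)| < 1) :
    1 ≤ B t := by
  have hpow : (1 : ℝ) ≤ (t : ℝ) ^ (2 * a) :=
    Real.one_le_rpow (by exact_mod_cast ht) (by linarith)
  have hpos : (0 : ℝ) < B t := by linarith [(abs_lt.1 hB).1]
  exact_mod_cast hpos

lemma inv_sqrt_le_of_abs_sub_lt {t : ℕ} (ht : 1 ≤ t)
    (hB : |(B t : ℝ) - (t : ℝ) ^ (2 * a)| < 1) : (√(B t))⁻¹ ≤ 2 * (t : ℝ) ^ (-a) := by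
  have ht₀ : (0 : ℝ) < t := by exact_mod_cast ht
  have hB₁ : (1 : ℝ) ≤ B t := by exact_mod_cast one_le_of_abs_sub_lt ha ht hB
  have hsqrt : (t : ℝ) ^ a / 2 ≤ √(B t) := by
    refine Real.le_sqrt_of_sq_le ?_
    have hsq : (t : ℝ) ^ (2 * a) = ((t : ℝ) ^ a) ^ 2 := by rw [two_mul, Real.rpow_add ht₀, sq]
    rw [div_pow, ← hsq]
    linarith [(abs_lt.1 hB).1]
  calc (√(B t))⁻¹ ≤ ((t : ℝ) ^ a / 2)⁻¹ := inv_anti₀ (by positivity) hsqrt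
    _ = 2 * (t : ℝ) ^ (-a) := by rw [Real.rpow_neg ht₀.le, inv_div, div_eq_mul_inv]

lemma isSchedule_of_rpow {b : ℝ} {η : ℕ → ℝ} {n₀ : ℕ} (hb : b ≤ 0)
    (hη : ∀ t : ℕ, 1 ≤ t → η t = (t : ℝ) ^ b)
    (hB : ∀ t : ℕ, 1 ≤ t → |(B t : ℝ) - (t : ℝ) ^ (2 * a)| < 1) (hn₀ : 1 ≤ n₀) :
    IsSchedule η n₀ B where
  step_mem t := by
    have ht : (1 : ℝ) ≤ (t + 1 : ℕ) := by exact_mod_cast Nat.le_add_left 1 t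
    rw [hη _ (Nat.le_add_left 1 t)]
    exact ⟨by positivity, Real.rpow_le_one_of_one_le_of_nonpos ht hb⟩
  step_one := by simp [hη 1 le_rfl]
  one_le_batch t := one_le_of_abs_sub_lt ha (Nat.le_add_left 1 t) (hB _ (Nat.le_add_left 1 t))
  one_le_init := hn₀

lemma exists_supersolution_of_rpow {b c M R : ℝ} (hb : -1 < b) (hb0 : b ≤ 0) (hc : 0 < c)
    (hc1 : c ≤ 1) (hM : 0 ≤ M) (hR : 0 < R) :
    ∃ K > 0, ∃ r : ℕ → ℝ, R ≤ r 0 ∧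
      (∀ (η : ℕ → ℝ) (B : ℕ → ℕ), (∀ t : ℕ, 1 ≤ t → η t = (t : ℝ) ^ b) →
        (∀ t : ℕ, 1 ≤ t → |(B t : ℝ) - (t : ℝ) ^ (2 * a)| < 1) →
        ∀ t, (1 - c * η (t + 1)) * r t + η (t + 1) * (M / √(B (t + 1))) ≤ r (t + 1)) ∧
      ∀ t : ℕ, 1 ≤ t → r t ≤ K * (t : ℝ) ^ (-a) := by
  obtain ⟨K, hK, r, hr₀, hr, hrK⟩ :=
    exists_supersolution ha.le hb hb0 hc hc1 (mul_nonneg hM zero_le_two) hR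
  refine ⟨K, hK, r, hr₀, fun η B hη hB t => le_trans ?_ (hr t), hrK⟩
  have ht : 1 ≤ t + 1 := Nat.le_add_left 1 t
  have ht₀ : (0 : ℝ) < (t + 1 : ℕ) := by positivity
  rw [hη _ ht, div_eq_mul_inv, sub_eq_add_neg b a, Real.rpow_add ht₀]
  have hnoise := mul_le_mul_of_nonneg_left (inv_sqrt_le_of_abs_sub_lt ha ht (hB _ ht))
    (mul_nonneg (Real.rpow_nonneg ht₀.le b) hM)
  linarith

end PowerSchedule

section IterationOf

variable {B : ℕ → ℕ} {N : ℕ}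

lemma lt_sum_iterationOf (hB : ∀ t, 1 ≤ t → 1 ≤ B t) (N : ℕ) :
    N < ∑ i ∈ Finset.Icc 1 (iterationOf B N), B i := by
  refine Nat.sInf_mem (s := {t : ℕ | N < ∑ i ∈ Finset.Icc 1 t, B i}) ⟨N + 1, ?_⟩
  have hcard : N + 1 ≤ ∑ i ∈ Finset.Icc 1 (N + 1), B i := by
    simpa using Finset.card_nsmul_le_sum (Finset.Icc 1 (N + 1)) B 1
      fun i hi => hB i (Finset.mem_Icc.1 hi).1
  exact hcard

lemma one_le_iterationOf (hB : ∀ t, 1 ≤ t → 1 ≤ B t) (N : ℕ) : 1 ≤ iterationOf B N := by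
  refine Nat.one_le_iff_ne_zero.2 fun h => ?_
  simpa [h] using lt_sum_iterationOf hB N

lemma le_two_mul_iterationOf_rpow {a : ℝ} (ha : 0 < a)
    (hB : ∀ t : ℕ, 1 ≤ t → |(B t : ℝ) - (t : ℝ) ^ (2 * a)| < 1) (N : ℕ) :
    (N : ℝ) ≤ 2 * (iterationOf B N : ℝ) ^ (2 * a + 1) := by
  have hB₁ : ∀ t, 1 ≤ t → 1 ≤ B t := fun t ht => one_le_of_abs_sub_lt ha ht (hB t ht)
  set t := iterationOf B N
  have ht₁ : (1 : ℝ) ≤ t := by exact_mod_cast one_le_iterationOf hB₁ N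
  calc (N : ℝ) ≤ ∑ i ∈ Finset.Icc 1 t, (B i : ℝ) := by exact_mod_cast (lt_sum_iterationOf hB₁ N).le
    _ ≤ ∑ i ∈ Finset.Icc 1 t, 2 * (t : ℝ) ^ (2 * a) := by
        refine Finset.sum_le_sum fun i hi => ?_
        obtain ⟨hi₁, hit⟩ := Finset.mem_Icc.1 hi
        have hpow : (1 : ℝ) ≤ (t : ℝ) ^ (2 * a) := Real.one_le_rpow ht₁ (by linarith)
        have hmono : (i : ℝ) ^ (2 * a) ≤ (t : ℝ) ^ (2 * a) := by gcongr
        linarith [(abs_lt.1 (hB i hi₁)).2]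
    _ = 2 * (t : ℝ) ^ (2 * a + 1) := by
        rw [Finset.sum_const, Nat.card_Icc, Nat.add_sub_cancel, nsmul_eq_mul,
          Real.rpow_add_one (by linarith)]
        ring

lemma iterationOf_rpow_neg_le {a : ℝ} (ha : 0 < a)
    (hB : ∀ t : ℕ, 1 ≤ t → |(B t : ℝ) - (t : ℝ) ^ (2 * a)| < 1) (hN : 1 ≤ N) :
    (iterationOf B N : ℝ) ^ (-a) ≤ 2 * (N : ℝ) ^ (-a / (2 * a + 1)) := by
  have hN₀ : (0 : ℝ) < N := by exact_mod_cast hN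
  have ha₂ : 0 < 2 * a + 1 := by linarith
  set p : ℝ := -a / (2 * a + 1) with hp
  have hp₀ : p ≤ 0 := div_nonpos_of_nonpos_of_nonneg (by linarith) ha₂.le
  have hp₁ : -p ≤ 1 := by rw [neg_le, hp, le_div_iff₀ ha₂]; linarith
  calc (iterationOf B N : ℝ) ^ (-a) = ((iterationOf B N : ℝ) ^ (2 * a + 1)) ^ p := by
        rw [← Real.rpow_mul (Nat.cast_nonneg _), hp, mul_div_cancel₀ _ ha₂.ne']
    _ ≤ ((N : ℝ) / 2) ^ p := Real.rpow_le_rpow_of_nonpos (by positivity)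
        (by linarith [le_two_mul_iterationOf_rpow ha hB N]) hp₀
    _ = (2 : ℝ) ^ (-p) * (N : ℝ) ^ p := by
        rw [Real.div_rpow hN₀.le zero_le_two, Real.rpow_neg zero_le_two]
        ring
    _ ≤ 2 * (N : ℝ) ^ p := by
        gcongr
        simpa using Real.rpow_le_rpow_of_exponent_le one_le_two hp₁

end IterationOf

lemma exp_neg_rpow_add_rpow_isBigO {c γ p : ℝ} (hc : 0 < c) (hγ : 0 < γ) :
    (fun N : ℕ => Real.exp (-c * (N : ℝ) ^ γ) + (N : ℝ) ^ p) =O[atTop]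
      fun N : ℕ => (N : ℝ) ^ p := by
  refine Asymptotics.IsBigO.add ?_ (Asymptotics.isBigO_refl _ _)
  have hpow : Tendsto (fun N : ℕ => (N : ℝ) ^ γ) atTop atTop :=
    (tendsto_rpow_atTop hγ).comp tendsto_natCast_atTop_atTop
  refine ((isLittleO_exp_neg_mul_rpow_atTop hc (p / γ)).comp_tendsto hpow).isBigO.congr_right
    fun N => ?_
  rw [Function.comp_apply, ← Real.rpow_mul (Nat.cast_nonneg N), mul_div_cancel₀ _ hγ.ne']

section OptimalPotentials

variable {E : Type*} {ε : ℝ} {C : E → E → ℝ}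

lemma couplingDensity_swap (f g : E → ℝ) (x y : E) :
    couplingDensity ε (fun y x => C x y) g f y x = couplingDensity ε C f g x y := by
  rw [couplingDensity, couplingDensity, add_comm]

lemma continuous_couplingDensity [TopologicalSpace E] (hC : Continuous (Function.uncurry C))
    (f g : C(E, ℝ)) : Continuous (Function.uncurry (couplingDensity ε C f g)) :=
  ((((f.continuous.comp continuous_fst).add (g.continuous.comp continuous_snd)).sub hC).div_const
    ε).rexp

lemma exists_couplingDensity_mem_Icc [TopologicalSpace E] [CompactSpace E]
    (hC : Continuous (Function.uncurry C)) (f g : C(E, ℝ)) :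
    ∃ R : ℝ≥0, 1 ≤ R ∧ ∀ x y, couplingDensity ε C f g x y ∈ Set.Icc (R : ℝ)⁻¹ R := by
  let u : C(E × E, ℝ) := ⟨fun z => (f z.1 + g z.2 - C z.1 z.2) / ε,
    (((f.continuous.comp continuous_fst).add (g.continuous.comp continuous_snd)).sub hC).div_const
      ε⟩
  refine ⟨(Real.exp ‖u‖).toNNReal, Real.one_le_toNNReal.2 (Real.one_le_exp (norm_nonneg u)),
    fun x y => ?_⟩
  obtain ⟨hlow, hup⟩ := abs_le.1 (u.norm_coe_le_norm (x, y))
  rw [Real.coe_toNNReal _ (Real.exp_pos _).le, ← Real.exp_neg]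
  exact ⟨Real.exp_le_exp.2 hlow, Real.exp_le_exp.2 hup⟩

lemma lipschitzWith_exp [PseudoMetricSpace E] {u : E → ℝ} {K R : ℝ≥0} (hu : LipschitzWith K u)
    (hR : ∀ x, Real.exp (u x) ≤ R) : LipschitzWith (R * K) fun x => Real.exp (u x) := by
  refine .of_le_add_mul _ fun x x' => ?_
  have huxx' : u x - u x' ≤ K * dist x x' := (le_abs_self _).trans (hu.dist_le_mul x x')
  calc Real.exp (u x) ≤ Real.exp (u x') + Real.exp (u x) * (u x - u x') := by
        have h := mul_le_mul_of_nonneg_left (Real.add_one_le_exp (u x' - u x))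
          (Real.exp_pos (u x)).le
        rw [← Real.exp_add, add_sub_cancel] at h
        linarith
    _ ≤ Real.exp (u x') + R * (K * dist x x') := by
        refine add_le_add_right ?_ _
        exact (mul_le_mul_of_nonneg_left huxx' (Real.exp_pos _).le).trans
          (mul_le_mul_of_nonneg_right (hR x) (by positivity))
    _ = Real.exp (u x') + (R * K : ℝ≥0) * dist x x' := by
        rw [NNReal.coe_mul, mul_assoc]

lemma lipschitzWith_couplingDensity [PseudoMetricSpace E] (hε : 0 < ε) {L R : ℝ≥0} {f g : E → ℝ}
    (hR : ∀ x y, couplingDensity ε C f g x y ≤ R) (hf : LipschitzWith L f)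
    (hC : ∀ y, LipschitzWith L (C · y)) (y : E) :
    LipschitzWith (R * (2 * L / ε.toNNReal)) (couplingDensity ε C f g · y) := by
  refine lipschitzWith_exp (.of_le_add_mul _ fun x x' => ?_) (hR · y)
  have hfxx' := (le_abs_self _).trans (hf.dist_le_mul x x')
  have hCxx' := (neg_le_abs _).trans ((hC y).dist_le_mul x x')
  rw [NNReal.coe_div, Real.coe_toNNReal _ hε.le, div_mul_eq_mul_div, ← add_div]
  gcongr
  push_cast
  linarith

section SoftTransform

variable [MeasurableSpace E] {μ : Measure E} [IsProbabilityMeasure μ] {h : E → ℝ}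
  (hint : ∀ x, Integrable (fun y => Real.exp ((h y - C x y) / ε)) μ)

include hint

lemma exp_neg_softTransform_div (hε : ε ≠ 0) (x : E) :
    Real.exp (-softTransform ε C μ h x / ε) = ∫ y, Real.exp ((h y - C x y) / ε) ∂μ := by
  rw [softTransform, neg_mul, neg_neg, mul_div_cancel_left₀ _ hε,
    Real.exp_log (integral_exp_pos (hint x))]

lemma integral_couplingDensity_eq_one (hε : ε ≠ 0) {f : E → ℝ} {x : E}
    (hf : f x = softTransform ε C μ h x) : ∫ y, couplingDensity ε C f h x y ∂μ = 1 := by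
  simp only [couplingDensity, add_sub_assoc, add_div, Real.exp_add, integral_const_mul, hf]
  rw [← exp_neg_softTransform_div hint hε, ← Real.exp_add, neg_div, add_neg_cancel, Real.exp_zero]

lemma lipschitzWith_softTransform [PseudoMetricSpace E] (hε : 0 < ε) {L : ℝ≥0}
    (hC : ∀ y, LipschitzWith L (C · y)) : LipschitzWith L (softTransform ε C μ h) := by
  refine .of_le_add_mul _ fun x x' => ?_
  have hle : Real.exp (-softTransform ε C μ h x' / ε) ≤
      Real.exp (L * dist x x' / ε) * Real.exp (-softTransform ε C μ h x / ε) := by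
    rw [exp_neg_softTransform_div hint hε.ne', exp_neg_softTransform_div hint hε.ne',
      ← integral_const_mul]
    refine integral_mono (hint x') ((hint x).const_mul _) fun y => ?_
    rw [← Real.exp_add, ← add_div]
    have hCxx' := (le_abs_self _).trans ((hC y).dist_le_mul x x')
    gcongr
    linarith
  rw [← Real.exp_add, ← add_div, Real.exp_le_exp, div_le_div_iff_of_pos_right hε] at hle
  linarith

end SoftTransform

section Compact

variable [PseudoMetricSpace E] [CompactSpace E] [MeasurableSpace E] [BorelSpace E] {μ : Measure E}
  [IsProbabilityMeasure μ]

lemma integrable_exp_sub_div (hC : Continuous (Function.uncurry C)) (h : C(E, ℝ)) (x : E) :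
    Integrable (fun y => Real.exp ((h y - C x y) / ε)) μ :=
  (((h.continuous.sub (hC.comp (Continuous.prodMk_right x))).div_const
    ε).rexp).integrable_of_hasCompactSupport (.of_compactSpace _)

lemma isMarkovDensity_couplingDensity (hε : ε ≠ 0) (hC : Continuous (Function.uncurry C))
    {f g : C(E, ℝ)} (hf : ∀ x, f x = softTransform ε C μ g x) {R : ℝ≥0} (hR : 1 ≤ R)
    (hmem : ∀ x y, couplingDensity ε C f g x y ∈ Set.Icc (R : ℝ)⁻¹ R) :
    IsMarkovDensity (couplingDensity ε C f g) μ R where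
  one_le := hR
  mem_Icc := hmem
  measurable x := ((continuous_couplingDensity hC f g).comp (Continuous.prodMk_right x)).measurable
  integral_eq_one x := integral_couplingDensity_eq_one (integrable_exp_sub_div hC g) hε (hf x)

end Compact

end OptimalPotentials

section PotentialError

lemma continuous_varNorm {T E : Type*} [TopologicalSpace T] [TopologicalSpace E] [CompactSpace E]
    {h : T → E → ℝ} (hh : Continuous (Function.uncurry h)) : Continuous fun t => varNorm (h t) := by
  have hsup := isCompact_univ.continuous_sSup (f := h) (K := (Set.univ : Set E)) hh
  have hinf := isCompact_univ.continuous_sInf (f := h) (K := (Set.univ : Set E)) hh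
  simp only [Set.image_univ] at hsup hinf
  exact hsup.sub hinf

lemma varNorm_nonneg {E : Type*} [TopologicalSpace E] [CompactSpace E] [Nonempty E] {h : E → ℝ}
    (hh : Continuous h) : 0 ≤ varNorm h :=
  sub_nonneg.2 (ciInf_le_ciSup (isCompact_range hh).bddBelow (isCompact_range hh).bddAbove)

variable {E : Type*} [TopologicalSpace E] {ε ρ : ℝ}
  {C : E → E → ℝ} {f g : C(E, ℝ)} {η : ℕ → ℝ} {n₀ : ℕ} {B : ℕ → ℕ}
  (hε : ε ≠ 0) (hs : IsSchedule η n₀ B) (hρ : 1 ≤ ρ)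
  (hk : ∀ x y, couplingDensity ε C f g x y ∈ Set.Icc ρ⁻¹ ρ)
  (hC : Continuous (Function.uncurry C))

include hs hρ hk hC

lemma continuous_neg_log_normalizedScalings (t : ℕ) :
    (Continuous fun p : (ℕ ⊕ ℕ → E) × E =>
      -Real.log ((normalizedScalings ε C f g η n₀ B p.1 t).1 p.2)) ∧
    Continuous fun p : (ℕ ⊕ ℕ → E) × E =>
      -Real.log ((normalizedScalings ε C f g η n₀ B p.1 t).2 p.2) := by
  have hcont := continuous_scalings hs hρ hk (fun y => Real.exp_pos (-g y / ε))
    (fun x => Real.exp_pos (-f x / ε)) (continuous_couplingDensity hC f g)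
    (g.continuous.neg.div_const ε).rexp (f.continuous.neg.div_const ε).rexp t
  have hpos := fun γ : ℕ ⊕ ℕ → E => ratioLE_normalizedScalings (γ := γ) hs hρ hk t
  exact ⟨(hcont.1.log fun p => ((hpos p.1).1.pos p.2).ne').neg,
    (hcont.2.log fun p => ((hpos p.1).2.pos p.2).ne').neg⟩

include hε

variable [CompactSpace E]

lemma continuous_potentialError (t : ℕ) : Continuous fun γ : ℕ ⊕ ℕ → E =>
    potentialError ε C η n₀ B f g (γ ∘ .inl) (γ ∘ .inr) t := by
  have hcont := continuous_neg_log_normalizedScalings hs hρ hk hC t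
  simp only [potentialError_eq hε hs hρ hk t]
  exact (continuous_varNorm hcont.1).add (continuous_varNorm hcont.2)

variable [Nonempty E]

lemma potentialError_nonneg (γ : ℕ ⊕ ℕ → E) (t : ℕ) :
    0 ≤ potentialError ε C η n₀ B f g (γ ∘ .inl) (γ ∘ .inr) t := by
  have hcont := continuous_neg_log_normalizedScalings hs hρ hk hC t
  rw [potentialError_eq hε hs hρ hk t]
  exact add_nonneg (varNorm_nonneg (hcont.1.comp (Continuous.prodMk_right γ)))
    (varNorm_nonneg (hcont.2.comp (Continuous.prodMk_right γ)))

lemma ExpectedRatioLE.integral_potentialError_mem_Icc [MeasurableSpace E] [BorelSpace E]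
    [SecondCountableTopology E] {Ω : Type*} [MeasurableSpace Ω] {P : Measure Ω}
    {Z : ℕ ⊕ ℕ → Ω → E} (hZ : ∀ i, Measurable (Z i)) {t : ℕ} {r : ℝ}
    (hr : ExpectedRatioLE P (fun ω => normalizedScalings ε C f g η n₀ B (Z · ω) t) r) :
    Integrable (fun ω => potentialError ε C η n₀ B f g ((Z · ω) ∘ .inl) ((Z · ω) ∘ .inr) t) P ∧
      ∫ ω, potentialError ε C η n₀ B f g ((Z · ω) ∘ .inl) ((Z · ω) ∘ .inr) t ∂P
        ∈ Set.Icc 0 (2 * r) := by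
  obtain ⟨θ, hθ, hratio, hθr⟩ := hr
  have hle : ∀ ω,
      potentialError ε C η n₀ B f g ((Z · ω) ∘ .inl) ((Z · ω) ∘ .inr) t ≤ 2 * θ ω := fun ω => by
    rw [potentialError_eq hε hs hρ hk t, two_mul]
    exact add_le_add (hratio ω).1.varNorm_neg_log_le (hratio ω).2.varNorm_neg_log_le
  have hmeas := (continuous_potentialError hε hs hρ hk hC t).measurable.comp
    (measurable_pi_lambda (fun ω => (Z · ω)) hZ)
  have hint := (hθ.const_mul 2).mono' hmeas.aestronglyMeasurable (.of_forall fun ω => by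
    rw [Function.comp_apply, Real.norm_of_nonneg (potentialError_nonneg hε hs hρ hk hC _ t)]
    exact hle ω)
  refine ⟨hint, integral_nonneg fun ω => potentialError_nonneg hε hs hρ hk hC (Z · ω) t,
    (integral_mono hint (hθ.const_mul 2) hle).trans ?_⟩
  rw [integral_const_mul]
  gcongr

end PotentialError

section Convergence

variable {E : Type*} [PseudoMetricSpace E] [CompactSpace E] [MeasurableSpace E] [BorelSpace E]
  {α β : Measure E} [IsProbabilityMeasure α] [IsProbabilityMeasure β] {ε : ℝ} {C : E → E → ℝ}
  {L : ℝ≥0} {f g : C(E, ℝ)} (hε : 0 < ε) (hC : LipschitzWith L (Function.uncurry C))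
  (hf : ∀ x, f x = softTransform ε C β g x)
  (hg : ∀ y, g y = softTransform ε (fun y x => C x y) α f y)

include hε hC hf hg

lemma exists_isMarkovDensity_and_lipschitzWith : ∃ ρ K : ℝ≥0,
    IsMarkovDensity (couplingDensity ε C f g) β ρ ∧
    IsMarkovDensity (fun y x => couplingDensity ε C f g x y) α ρ ∧
    (∀ y, LipschitzWith K (couplingDensity ε C f g · y)) ∧
    ∀ x, LipschitzWith K (couplingDensity ε C f g x) := by
  have hCl : ∀ y, LipschitzWith L (C · y) := fun y =>
    mul_one L ▸ hC.comp (LipschitzWith.prodMk_right y)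
  have hCr : ∀ x, LipschitzWith L (C x) := fun x =>
    mul_one L ▸ hC.comp (LipschitzWith.prodMk_left x)
  have hCc' : Continuous (Function.uncurry fun y x => C x y) := hC.continuous.comp continuous_swap
  have hfL : LipschitzWith L f := funext hf ▸ lipschitzWith_softTransform
    (integrable_exp_sub_div hC.continuous g) hε hCl
  have hgL : LipschitzWith L g := funext hg ▸ lipschitzWith_softTransform
    (integrable_exp_sub_div hCc' f) hε hCr
  obtain ⟨ρ, hρ, hmem⟩ := exists_couplingDensity_mem_Icc (ε := ε) hC.continuous f g
  have hswap : couplingDensity ε (fun y x => C x y) g f = fun y x => couplingDensity ε C f g x y :=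
    funext₂ fun y x => couplingDensity_swap f g x y
  have hmem' : ∀ y x, couplingDensity ε (fun y x => C x y) g f y x ∈ Set.Icc (ρ : ℝ)⁻¹ ρ :=
    fun y x => hswap ▸ hmem x y
  refine ⟨ρ, ρ * (2 * L / ε.toNNReal),
    isMarkovDensity_couplingDensity hε.ne' hC.continuous hf hρ hmem, ?_,
    lipschitzWith_couplingDensity hε (fun x y => (hmem x y).2) hfL hCl, fun x => ?_⟩
  · exact hswap ▸ isMarkovDensity_couplingDensity hε.ne' hCc' hg hρ hmem'
  · simpa only [couplingDensity_swap] using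
      lipschitzWith_couplingDensity hε (fun y x => (hmem' y x).2) hgL hCr x

lemma exists_integral_potentialError_mem_Icc {A : ℕ} (hA : HasGeometricCovering E A) {a b : ℝ}
    (ha : 0 < a) (hb : -1 < b) (hb0 : b ≤ 0) :
    ∃ K > 0, ∀ (Ω : Type*) [MeasurableSpace Ω] (P : Measure Ω) [IsProbabilityMeasure P]
      (Z : ℕ ⊕ ℕ → Ω → E), (∀ i, Measurable (Z i)) → (∀ i, P.map (Z (.inl i)) = α) →
      (∀ i, P.map (Z (.inr i)) = β) → iIndepFun Z P →
      ∀ (η : ℕ → ℝ) (B : ℕ → ℕ) (n₀ : ℕ), (∀ t : ℕ, 1 ≤ t → η t = (t : ℝ) ^ b) →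
        (∀ t : ℕ, 1 ≤ t → |(B t : ℝ) - (t : ℝ) ^ (2 * a)| < 1) → 1 ≤ n₀ → ∀ t : ℕ, 1 ≤ t →
          Integrable
            (fun ω => potentialError ε C η n₀ B f g ((Z · ω) ∘ .inl) ((Z · ω) ∘ .inr) t) P ∧
          ∫ ω, potentialError ε C η n₀ B f g ((Z · ω) ∘ .inl) ((Z · ω) ∘ .inr) t ∂P
            ∈ Set.Icc 0 (K * (t : ℝ) ^ (-a)) := by
  have : Nonempty E := nonempty_of_isProbabilityMeasure α
  obtain ⟨ρ, K, hkβ, hkα, hkL, hkL'⟩ := exists_isMarkovDensity_and_lipschitzWith hε hC hf hg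
  have hkc := continuous_couplingDensity (ε := ε) hC.continuous f g
  have hρ := hkβ.pos
  have hA₁ : (1 : ℝ) ≤ A := by exact_mod_cast hA.one_le
  have hlog : 0 ≤ Real.log (4 * A) := Real.log_nonneg (by linarith)
  set ℓ : ℝ≥0 := max (ρ ^ 3) (ρ ^ 2 * K)
  obtain ⟨K', hK', r, hr₀, hr, hrK⟩ := exists_supersolution_of_rpow ha hb hb0
    (c := (ρ : ℝ)⁻¹ / ρ ^ 6) (M := 4 * ρ ^ 17 * (ℓ * (7 * Real.log (4 * A) + 1))) (R := ρ ^ 2)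
    (by positivity) ((div_le_one (by positivity)).2
      ((inv_le_one_of_one_le₀ hkβ.one_le).trans (one_le_pow₀ hkβ.one_le)))
    (by positivity) (by positivity)
  refine ⟨2 * K', by positivity, fun Ω _ P _ Z hZ hα hβ hind η B n₀ hη hB hn₀ t ht => ?_⟩
  have hs := isSchedule_of_rpow ha hb0 hη hB hn₀
  have hratio := expectedRatioLE_scalings (ℓ := ℓ) (r := r) hA hZ hind hα hβ hs hkβ hkα hkc hkL
    hkL' (by exact_mod_cast le_max_left _ _) (by exact_mod_cast le_max_right _ _)
    (fun y => Real.exp_pos (-g y / ε)) (fun x => Real.exp_pos (-f x / ε))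
    (g.continuous.neg.div_const ε).rexp (f.continuous.neg.div_const ε).rexp (by linarith)
    (fun t => by
      refine (le_of_eq ?_).trans (hr η B hη hB t)
      ring) t
  obtain ⟨hint, hpos, hle⟩ :=
    hratio.integral_potentialError_mem_Icc hε.ne' hs hkβ.one_le hkβ.mem_Icc hC.continuous hZ
  exact ⟨hint, hpos, by linarith [hrK t ht]⟩

end Convergence

end OnlineSinkhorn

end

open OnlineSinkhorn

theorem theorem1_general {E : Type*} [PseudoMetricSpace E] [CompactSpace E] [MeasurableSpace E]
    [BorelSpace E] {A : ℕ} (hA : HasGeometricCovering E A) (α β : Measure E)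
    [IsProbabilityMeasure α] [IsProbabilityMeasure β] (C : E → E → ℝ) (L : ℝ≥0)
    (hC : LipschitzWith L (fun z : E × E => C z.1 z.2)) (ε : ℝ) (hε : 0 < ε) (f g : C(E, ℝ))
    (hf : ∀ x, f x = softTransform ε C β g x)
    (hg : ∀ y, g y = softTransform ε (fun y x => C x y) α f y)
    (a b : ℝ) (ha : 0 < a) (hb : -1 < b) (hb0 : b ≤ 0) :
    ∃ c > 0, ∃ K > 0,
      (fun N : ℕ => Real.exp (-c * (N : ℝ) ^ ((b + 1) / (2 * a + 1)))
          + (N : ℝ) ^ (-a / (2 * a + 1)))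
        =O[atTop] (fun N : ℕ => (N : ℝ) ^ (-a / (2 * a + 1))) ∧
      ∀ (Ω : Type*) [MeasurableSpace Ω] (P : Measure Ω) [IsProbabilityMeasure P]
        (x y : ℕ → Ω → E),
        (∀ i, Measurable (x i)) → (∀ i, Measurable (y i)) →
        (∀ i, P.map (x i) = α) → (∀ i, P.map (y i) = β) →
        iIndepFun (Sum.elim x y) P →
        ∀ (η : ℕ → ℝ) (B : ℕ → ℕ) (n₀ : ℕ),
          (∀ t : ℕ, 1 ≤ t → η t = (t : ℝ) ^ b) →
          (∀ t : ℕ, 1 ≤ t → |(B t : ℝ) - (t : ℝ) ^ (2 * a)| < 1) →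
          1 ≤ n₀ →
          (∀ N : ℕ, 1 ≤ N →
            Integrable (fun ω => potentialError ε C η n₀ B f g
              (fun i => x i ω) (fun i => y i ω) (iterationOf B N)) P ∧
            ∫ ω, potentialError ε C η n₀ B f g
                (fun i => x i ω) (fun i => y i ω) (iterationOf B N) ∂P
              ≤ K * (Real.exp (-c * (N : ℝ) ^ ((b + 1) / (2 * a + 1)))
                  + (N : ℝ) ^ (-a / (2 * a + 1)))) ∧
          (fun N : ℕ => ∫ ω, potentialError ε C η n₀ B f g
                (fun i => x i ω) (fun i => y i ω) (iterationOf B N) ∂P)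
            =O[atTop] (fun N : ℕ => (N : ℝ) ^ (-a / (2 * a + 1))) := by
  obtain ⟨K, hK, hbound⟩ := exists_integral_potentialError_mem_Icc hε hC hf hg hA ha hb hb0
  refine ⟨1, one_pos, 2 * K, by positivity,
    exp_neg_rpow_add_rpow_isBigO one_pos (div_pos (by linarith) (by linarith)), ?_⟩
  intro Ω _ P _ x y hx hy hα hβ hind η B n₀ hη hB hn₀
  have hB₁ : ∀ t, 1 ≤ t → 1 ≤ B t := fun t ht => one_le_of_abs_sub_lt ha ht (hB t ht)
  have herror := fun N => hbound Ω P (Sum.elim x y) (Sum.forall.2 ⟨hx, hy⟩) hα hβ hind η B n₀ hη hB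
    hn₀ (iterationOf B N) (one_le_iterationOf hB₁ N)
  have hrate : ∀ N : ℕ, 1 ≤ N → K * (iterationOf B N : ℝ) ^ (-a) ≤
      2 * K * (N : ℝ) ^ (-a / (2 * a + 1)) := fun N hN => by
    linarith [mul_le_mul_of_nonneg_left (iterationOf_rpow_neg_le ha hB hN) hK.le]
  refine ⟨fun N hN => ⟨(herror N).1, (herror N).2.2.trans ((hrate N hN).trans ?_)⟩, ?_⟩
  · gcongr
    exact le_add_of_nonneg_left (Real.exp_pos _).le
  · refine .of_bound (2 * K) (eventually_atTop.2 ⟨1, fun N hN => ?_⟩)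
    rw [Real.norm_of_nonneg (Real.rpow_nonneg (Nat.cast_nonneg N) _)]
    exact (Real.norm_of_nonneg (herror N).2.1).trans_le ((herror N).2.2.trans (hrate N hN))

theorem theorem1 (d : ℕ) (X : Set (EuclideanSpace ℝ (Fin d))) (hX : IsCompact X)
    (α β : Measure X) [IsProbabilityMeasure α] [IsProbabilityMeasure β]
    (C : X → X → ℝ) (L : ℝ≥0) (hC : LipschitzWith L (fun z : X × X => C z.1 z.2))
    (ε : ℝ) (hε : 0 < ε) (fstar gstar : C(X, ℝ))
    (hopt : OnlineSinkhorn.IsOptimalPair ε C α β fstar gstar)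
    (a b : ℝ) (hb : -1 < b) (hb' : b < -1 / 2) (hab : 1 < a - b) :
    ∃ c > 0, ∃ K > 0,
      (fun N : ℕ => Real.exp (-c * (N : ℝ) ^ ((b + 1) / (2 * a + 1)))
          + (N : ℝ) ^ (-a / (2 * a + 1)))
        =O[atTop] (fun N : ℕ => (N : ℝ) ^ (-a / (2 * a + 1))) ∧
      ∀ (Ω : Type*) [MeasurableSpace Ω] (P : Measure Ω) [IsProbabilityMeasure P]
        (x y : ℕ → Ω → X),
        (∀ i, Measurable (x i)) → (∀ i, Measurable (y i)) →
        (∀ i, P.map (x i) = α) → (∀ i, P.map (y i) = β) →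
        iIndepFun (Sum.elim x y) P →
        ∀ (η : ℕ → ℝ) (B : ℕ → ℕ) (n₀ : ℕ),
          (∀ t : ℕ, 1 ≤ t → η t = (t : ℝ) ^ b) →
          (∀ t : ℕ, 1 ≤ t → |(B t : ℝ) - (t : ℝ) ^ (2 * a)| < 1) →
          1 ≤ n₀ →
          (∀ N : ℕ, 1 ≤ N →
            Integrable (fun ω => OnlineSinkhorn.potentialError ε C η n₀ B fstar gstar
              (fun i => x i ω) (fun i => y i ω) (OnlineSinkhorn.iterationOf B N)) P ∧
            ∫ ω, OnlineSinkhorn.potentialError ε C η n₀ B fstar gstar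
                (fun i => x i ω) (fun i => y i ω) (OnlineSinkhorn.iterationOf B N) ∂P
              ≤ K * (Real.exp (-c * (N : ℝ) ^ ((b + 1) / (2 * a + 1)))
                  + (N : ℝ) ^ (-a / (2 * a + 1)))) ∧
          (fun N : ℕ => ∫ ω, OnlineSinkhorn.potentialError ε C η n₀ B fstar gstar
                (fun i => x i ω) (fun i => y i ω) (OnlineSinkhorn.iterationOf B N) ∂P)
            =O[atTop] (fun N : ℕ => (N : ℝ) ^ (-a / (2 * a + 1))) := by
  have : CompactSpace X := isCompact_iff_compactSpace.1 hX
  obtain ⟨A, hA⟩ := exists_hasGeometricCovering hX.isBounded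
  exact theorem1_general hA α β C L hC ε hε fstar gstar hopt.eq_left hopt.eq_right a b
    (by linarith) hb (by linarith)
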